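/- For $n \ge 1$ let $\mu_n$ be the Curie–Weiss (mean-field Ising) measure at inverse temperature $\beta \ge 0$ on $\Omega_n = \{-1,1\}^n$, $$\mu_n(\sigma) = \frac{1}{Z_n(\beta)} \exp\Bigl(\frac{\beta}{n} \sum_{1 \le i < j \le n} \sigma(i)\sigma(j)\Bigr),$$ where $Z_n(\beta)$ is the normalizing constant. The Glauber dynamics for $\mu_n$ is the discrete-time Markov chain $(X_t)_{t \ge 0}$ on $\Omega_n$ that, when at $\sigma$, chooses a vertex $v \in \{1,\dots,n\}$ uniformly at random and moves to a configuration drawn from $\mu_n$ conditioned on the set $\{\eta \in \Omega_n : \eta(w) = \sigma(w) \text{ for all } w \ne v\}$. Let $$d_n(t) = \max_{\sigma \in \Omega_n} \bigl\| \mathbf{P}_\sigma(X_t \in \cdot) - \mu_n \bigr\|_{\mathrm{TV}}, \qquad t_{\mathrm{mix}}(n) = \min\{t \in \mathbb{N} : d_n(t) \le 1/4\},$$ where $\mathbf{P}_\sigma$ is the law of the chain started at $X_0 = \sigma$ and $\|\mu - \nu\|_{\mathrm{TV}} = \frac12 \sum_{x} |\mu(x) - \nu(x)|$ is the total variation distance.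 Theorem. If $\beta = 1$, then there are constants $C_1, C_2 > 0$ such that for all $n \ge 1$, $$C_1 n^{3/2} \le t_{\mathrm{mix}}(n) \le C_2 n^{3/2}.$$ -/

import Mathlib

namespace CurieWeiss

/-- Configurations: an assignment of a spin in `{-1, 1}` to every element of `V`.
The units of `ℤ` are exactly `1` and `-1`. -/
abbrev Config (V : Type*) : Type _ := V → ℤˣ

/-- The spin of `σ` at `v` as a real number. -/
def spin {V : Type*} (σ : Config V) (v : V) : ℝ := ((σ v : ℤ) : ℝ)

/-- The Boltzmann weight `exp ((β / n) ∑_{i < j} σ(i) σ(j))` of the Ising model on the complete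
graph on `n` vertices with interaction strength `J = 1 / n`. -/
noncomputable def weight (n : ℕ) (β : ℝ) (σ : Config (Fin n)) : ℝ :=
  Real.exp (β / n * ∑ i : Fin n, ∑ j ∈ Finset.Ioi i, spin σ i * spin σ j)

/-- The normalizing constant `Z(β)`. -/
noncomputable def partitionFunction (n : ℕ) (β : ℝ) : ℝ :=
  ∑ σ : Config (Fin n), weight n β σ

/-- The Curie-Weiss (mean-field Ising) measure, given by its probability mass function. -/
noncomputable def gibbs (n : ℕ) (β : ℝ) (σ : Config (Fin n)) : ℝ :=
  weight n β σ / partitionFunction n β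

/-- The configurations that agree with `σ` everywhere except possibly at `v`. -/
def agreeOff {V : Type*} [Fintype V] [DecidableEq V] (σ : Config V) (v : V) :
    Finset (Config V) :=
  Finset.univ.filter fun η => ∀ w, w ≠ v → η w = σ w

/-- The transition matrix of the single-site Glauber dynamics for a probability mass function `μ`
on configurations: a vertex `v` is chosen uniformly at random, and the new configuration is drawn
from `μ` conditioned on the set of configurations that agree with the current one off `v`. -/
noncomputable def glauber {V : Type*} [Fintype V] [DecidableEq V] (μ : Config V → ℝ) :
    Matrix (Config V) (Config V) ℝ :=
  Matrix.of fun σ η => ∑ v : V, (1 / (Fintype.card V : ℝ)) *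
    (if η ∈ agreeOff σ v then μ η / ∑ ξ ∈ agreeOff σ v, μ ξ else 0)

/-- The law of `X_t` under `P_σ`, where `X` is the Glauber dynamics for the Curie-Weiss measure
started at `X_0 = σ`: the row of `σ` in the `t`-th power of the transition matrix. -/
noncomputable def law (n : ℕ) (β : ℝ) (t : ℕ) (σ η : Config (Fin n)) : ℝ :=
  (glauber (gibbs n β) ^ t) σ η

/-- Total variation distance between two probability mass functions on a finite set. -/
noncomputable def tvDist {Ω : Type*} [Fintype Ω] (μ ν : Ω → ℝ) : ℝ :=
  (1 / 2) * ∑ x : Ω, |μ x - ν x|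

/-- The worst-case distance to stationarity `d_n(t)`; the supremum is over a finite nonempty
set, hence a maximum. -/
noncomputable def distToStationarity (n : ℕ) (β : ℝ) (t : ℕ) : ℝ :=
  ⨆ σ : Config (Fin n), tvDist (law n β t σ) (gibbs n β)

/-- The mixing time `min {t : d_n(t) ≤ 1/4}`. For an empty set the infimum in `ℕ` would be `0`, so
a positive value of `tMix n β` is an honest minimum. -/
noncomputable def tMix (n : ℕ) (β : ℝ) : ℕ :=
  sInf {t : ℕ | distToStationarity n β t ≤ 1 / 4}

end CurieWeiss

/-!
The critical Glauber dynamics mixes on the scale `n ^ (3 / 2)` because the magnetization `M`, the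
sum of the spins, has a drift of order `-M ^ 3 / n ^ 3` per step (at `β = 1` the linear part of
`tanh` cancels) and jumps of variance of order one. Noise and drift balance at `M ≈ n ^ (3 / 4)`,
which takes `n ^ (3 / 2)` steps to diffuse. All arguments below concern the operator
`step n f σ = E_σ[f(X₁)]` on observables and its iterates; no path space is needed.

*Lower bound.* An odd `C¹` truncation of `M / n ^ (3 / 4)` has Gibbs mean zero, equals `1` at the
all-plus configuration, and decreases in expectation by at most a multiple of `n ^ (-3 / 2)` per
step (`step_cutoff_ge`): outside the critical window it is constant, inside it the drift is
`O(n ^ (-3 / 4))`. So it still separates the two laws after `n ^ (3 / 2) / 40` steps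
(`le_of_distToStationarity_le`).

*Upper bound.* Let `f` be an observable bounded by one; by stationarity it suffices to bound the
oscillation of its iterate. First, the iterates of `f` nearly become functions of the number of
plus spins. The chains started at two configurations that differ by a transposition can be run as
mirror images until the two exchanged spins agree, which happens with probability of order `1 / n`
in each step (`abs_step_sub_step_swap_le`). After `n ^ (3 / 2)` steps the error
`n (1 - c / n) ^ t` is negligible.

Second, the number of plus spins is a birth-and-death chain (`step_comp_plusCount`), and two copies
of it are coupled by `pairStep` so that they cannot cross. With `D` their distance and
`A = n ^ (3 / 4)`, the drift of `D` is at most a negative multiple of `D ^ 3 / n ^ 3`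
(`drift_sub_drift_le`), so the bounded concave function `D / (A + D)` decreases in expectation by a
multiple of `A ^ (-2) = n ^ (-3 / 2)` as long as `D ≠ 0` (`concave_step_le`,
`pairStep_distance_le`). Its boundedness makes the expected coalescence time `O(n ^ (3 / 2))` from
every starting point, and Markov's inequality (`abs_iterate_countStep_sub_le`) concludes.
-/

namespace CurieWeiss

open Real Finset

variable {n : ℕ}

/-! ### The hyperbolic tangent -/

lemma hasDerivAt_tanh (x : ℝ) : HasDerivAt tanh (1 - tanh x ^ 2) x := by
  have hc := (cosh_pos x).ne'
  have h := (hasDerivAt_sinh x).div (hasDerivAt_cosh x) hc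
  have he : (fun y => sinh y / cosh y) = tanh := by
    funext y; rw [tanh_eq_sinh_div_cosh]
  rw [show (sinh / cosh : ℝ → ℝ) = tanh from he] at h
  refine h.congr_deriv ?_
  rw [tanh_eq_sinh_div_cosh]
  field_simp

lemma tanh_mono : Monotone tanh := by
  refine monotone_of_deriv_nonneg (fun x => (hasDerivAt_tanh x).differentiableAt) fun x => ?_
  rw [(hasDerivAt_tanh x).deriv]
  linarith [tanh_sq_lt_one x]

lemma tanh_le_self {x : ℝ} (hx : 0 ≤ x) : tanh x ≤ x := by
  have : Monotone fun y => y - tanh y := by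
    refine monotone_of_hasDerivAt_nonneg
      (fun y => (hasDerivAt_id y).sub (hasDerivAt_tanh y)) fun y => ?_
    simp only [Pi.zero_apply]
    nlinarith [sq_nonneg (tanh y)]
  have h := this hx
  simp only [tanh_zero] at h
  linarith

lemma tanh_nonneg {x : ℝ} (hx : 0 ≤ x) : 0 ≤ tanh x := by
  simpa using tanh_mono hx

lemma tanh_sq_le (x : ℝ) : tanh x ^ 2 ≤ x ^ 2 := by
  rcases le_total 0 x with h | h
  · exact pow_le_pow_left₀ (tanh_nonneg h) (tanh_le_self h) 2
  · have h' : 0 ≤ -x := by linarith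
    have := pow_le_pow_left₀ (tanh_nonneg h') (tanh_le_self h') 2
    simpa [tanh_neg] using this

lemma abs_tanh_sub_self_le (x : ℝ) : |tanh x - x| ≤ |x| ^ 3 := by
  have hm : Monotone fun y => tanh y - y + y ^ 3 / 3 := by
    refine monotone_of_hasDerivAt_nonneg
      (fun y => ((hasDerivAt_tanh y).sub (hasDerivAt_id y)).add
        ((hasDerivAt_pow 3 y).div_const 3)) fun y => ?_
    simp only [Pi.zero_apply]
    have := tanh_sq_le y
    norm_num
    linarith
  have key : ∀ y : ℝ, 0 ≤ y → |tanh y - y| ≤ |y| ^ 3 := fun y hy => by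
    have h := hm hy
    simp only [tanh_zero] at h
    have h3 : 0 ≤ y ^ 3 := by positivity
    rw [abs_of_nonneg hy, abs_le]
    constructor <;> nlinarith [tanh_le_self hy]
  rcases le_total 0 x with h | h
  · exact key x h
  · have := key (-x) (by linarith)
    rw [tanh_neg, abs_neg] at this
    rwa [show -tanh x - -x = -(tanh x - x) by ring, abs_neg] at this

/-- This is `1 + 2 x ≤ exp (2 x)` in disguise. -/
lemma div_one_add_le_tanh {x : ℝ} (hx : 0 ≤ x) : x / (1 + x) ≤ tanh x := by
  have h1 : 1 + 2 * x ≤ exp (2 * x) := by linarith [add_one_le_exp (2 * x)]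
  have h2 : exp (2 * x) = exp x * exp x := by rw [← exp_add]; ring_nf
  have h3 : exp x * exp (-x) = 1 := by rw [← exp_add]; simp
  have hp := exp_pos x
  have hn := exp_pos (-x)
  rw [tanh_eq_sinh_div_cosh, div_le_div_iff₀ (by linarith) (cosh_pos x), sinh_eq, cosh_eq]
  have h4 : exp (-x) * (1 + 2 * x) ≤ exp x := by
    calc exp (-x) * (1 + 2 * x) ≤ exp (-x) * (exp x * exp x) := by
          rw [← h2]; gcongr
      _ = exp x * (exp x * exp (-x)) := by ring
      _ = exp x := by rw [h3, mul_one]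
  nlinarith

lemma sq_div_nine_le_tanh_sq {x : ℝ} (hx : |x| ≤ 2) : x ^ 2 / 9 ≤ tanh x ^ 2 := by
  have key : ∀ y : ℝ, 0 ≤ y → y ≤ 2 → y ^ 2 / 9 ≤ tanh y ^ 2 := fun y h0 h2 => by
    have h1 : y / 3 ≤ tanh y := by
      refine le_trans ?_ (div_one_add_le_tanh h0)
      gcongr
      linarith
    have := pow_le_pow_left₀ (by positivity) h1 2
    calc y ^ 2 / 9 = (y / 3) ^ 2 := by ring
      _ ≤ _ := this
  rw [abs_le] at hx
  rcases le_total 0 x with h | h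
  · exact key x h hx.2
  · simpa [tanh_neg] using key (-x) (by linarith) (by linarith)

/-! ### The drift of the magnetization -/

/-- The drift of the magnetization under one step of the dynamics, as a function of the
normalized magnetization `s`; here `h = 1 / n`. -/
noncomputable def drift (h s : ℝ) : ℝ :=
  -s + (1 - s) / 2 * tanh (s + h) + (1 + s) / 2 * tanh (s - h)

lemma abs_drift_le {h s : ℝ} (hh : 0 ≤ h) (hs : |s| ≤ 1) :
    |drift h s| ≤ |s| * h + (|s| + h) ^ 3 := by
  have hs' := abs_le.1 hs
  have h1 : |tanh (s + h) - (s + h)| ≤ (|s| + h) ^ 3 :=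
    (abs_tanh_sub_self_le _).trans (by
      gcongr
      exact (abs_add_le s h).trans (by rw [abs_of_nonneg hh]))
  have h2 : |tanh (s - h) - (s - h)| ≤ (|s| + h) ^ 3 :=
    (abs_tanh_sub_self_le _).trans (by
      gcongr
      exact (abs_sub s h).trans (by rw [abs_of_nonneg hh]))
  have e : drift h s = -(s * h) + ((1 - s) / 2 * (tanh (s + h) - (s + h)) +
      (1 + s) / 2 * (tanh (s - h) - (s - h))) := by
    unfold drift; ring
  have a1 : |(1 - s) / 2 * (tanh (s + h) - (s + h))| ≤ (1 - s) / 2 * (|s| + h) ^ 3 := by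
    rw [abs_mul, abs_of_nonneg (by linarith : 0 ≤ (1 - s) / 2)]
    exact mul_le_mul_of_nonneg_left h1 (by linarith)
  have a2 : |(1 + s) / 2 * (tanh (s - h) - (s - h))| ≤ (1 + s) / 2 * (|s| + h) ^ 3 := by
    rw [abs_mul, abs_of_nonneg (by linarith : 0 ≤ (1 + s) / 2)]
    exact mul_le_mul_of_nonneg_left h2 (by linarith)
  rw [e]
  refine (abs_add_le _ _).trans ?_
  rw [abs_neg, abs_mul, abs_of_nonneg hh]
  have := abs_add_le ((1 - s) / 2 * (tanh (s + h) - (s + h)))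
    ((1 + s) / 2 * (tanh (s - h) - (s - h)))
  linarith

/-- The constant in the cubic restoring force of the drift. -/
noncomputable def driftConst : ℝ := min (1 / 9) ((1 - tanh 2 ^ 2) / 2)

lemma driftConst_pos : 0 < driftConst := by
  refine lt_min (by norm_num) ?_
  linarith [tanh_sq_lt_one 2]

lemma tanh_sub_tanh_ge {s h : ℝ} (hh : 0 ≤ h) (h1 : h ≤ 1) (hs : |s| ≤ 1) :
    (1 - tanh 2 ^ 2) * (2 * h) ≤ tanh (s + h) - tanh (s - h) := by
  have hs' := abs_le.1 hs
  have hm : MonotoneOn (fun y => tanh y - (1 - tanh 2 ^ 2) * y) (Set.Icc (-2) 2) := by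
    have hd : ∀ y, HasDerivAt (fun y => tanh y - (1 - tanh 2 ^ 2) * y)
        ((1 - tanh y ^ 2) - (1 - tanh 2 ^ 2) * 1) y := fun y =>
      (hasDerivAt_tanh y).sub ((hasDerivAt_id y).const_mul _)
    refine monotoneOn_of_deriv_nonneg (convex_Icc _ _)
      (fun y _ => (hd y).continuousAt.continuousWithinAt)
      (fun y _ => (hd y).differentiableAt.differentiableWithinAt) fun y hy => ?_
    rw [interior_Icc] at hy
    rw [(hd y).deriv]
    have u1 := tanh_mono hy.2.le
    have u2 := tanh_mono hy.1.le
    rw [tanh_neg] at u2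
    nlinarith
  have := hm (a := s - h) (b := s + h) ⟨by linarith, by linarith⟩ ⟨by linarith, by linarith⟩
    (by linarith)
  simp only at this
  linarith

lemma hasDerivAt_drift (h s : ℝ) :
    HasDerivAt (drift h) (-((1 - s) / 2 * tanh (s + h) ^ 2 + (1 + s) / 2 * tanh (s - h) ^ 2)
      - (tanh (s + h) - tanh (s - h)) / 2) s := by
  have a := (hasDerivAt_tanh (s + h)).comp_add_const s h
  have b := (hasDerivAt_tanh (s - h)).comp_sub_const s h
  have c : HasDerivAt (fun y : ℝ => (1 - y) / 2) (-1 / 2) s :=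
    ((hasDerivAt_id s).const_sub 1).div_const 2
  have d : HasDerivAt (fun y : ℝ => (1 + y) / 2) (1 / 2) s :=
    ((hasDerivAt_id s).const_add 1).div_const 2
  have := ((hasDerivAt_id s).neg.add (c.mul a)).add (d.mul b)
  refine this.congr_deriv ?_
  ring

/-- The second derivative of `tanh` contributes the term `tanh (s + h) - tanh (s - h)`, which is
only needed when `h` is not small. -/
lemma deriv_drift_le {h s : ℝ} (hh : 0 ≤ h) (h1 : h ≤ 1) (hs : |s| ≤ 1) :
    -((1 - s) / 2 * tanh (s + h) ^ 2 + (1 + s) / 2 * tanh (s - h) ^ 2)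
      - (tanh (s + h) - tanh (s - h)) / 2 ≤ -(driftConst * s ^ 2) := by
  have hs' := abs_le.1 hs
  have t := tanh_sub_tanh_ge hh h1 hs
  have k1 : driftConst ≤ 1 / 9 := min_le_left _ _
  have k2 : driftConst ≤ (1 - tanh 2 ^ 2) / 2 := min_le_right _ _
  have k0 := driftConst_pos
  have a1 : driftConst * (s + h) ^ 2 ≤ tanh (s + h) ^ 2 := by
    have := sq_div_nine_le_tanh_sq (x := s + h) (by rw [abs_le]; constructor <;> linarith)
    nlinarith [sq_nonneg (s + h)]
  have a2 : driftConst * (s - h) ^ 2 ≤ tanh (s - h) ^ 2 := by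
    have := sq_div_nine_le_tanh_sq (x := s - h) (by rw [abs_le]; constructor <;> linarith)
    nlinarith [sq_nonneg (s - h)]
  have b1 := mul_le_mul_of_nonneg_left a1 (by linarith : 0 ≤ (1 - s) / 2)
  have b2 := mul_le_mul_of_nonneg_left a2 (by linarith : 0 ≤ (1 + s) / 2)
  have c : driftConst * (2 * h) ≤ (tanh (s + h) - tanh (s - h)) / 2 := by nlinarith
  have s2 : s ^ 2 ≤ 1 := by nlinarith
  have e : driftConst * s ^ 2 ≤ (1 - s) / 2 * (driftConst * (s + h) ^ 2) +
      (1 + s) / 2 * (driftConst * (s - h) ^ 2) + driftConst * (2 * h) := by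
    have : 0 ≤ driftConst * (h ^ 2 + 2 * h * (1 - s ^ 2)) := by
      have : 0 ≤ h * (1 - s ^ 2) := mul_nonneg hh (by linarith)
      positivity
    nlinarith
  linarith

lemma drift_sub_drift_le {h s s' : ℝ} (hh : 0 ≤ h) (h1 : h ≤ 1) (hs : |s| ≤ 1) (hs' : |s'| ≤ 1)
    (hle : s' ≤ s) : drift h s - drift h s' ≤ -(driftConst / 12) * (s - s') ^ 3 := by
  have hd : ∀ y, HasDerivAt (fun y => drift h y + driftConst * (y ^ 3 / 3)) _ y := fun y =>
    (hasDerivAt_drift h y).add (((hasDerivAt_pow 3 y).div_const 3).const_mul driftConst)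
  have ha : AntitoneOn (fun y => drift h y + driftConst * (y ^ 3 / 3)) (Set.Icc (-1) 1) := by
    refine antitoneOn_of_deriv_nonpos (convex_Icc _ _)
      (fun y _ => (hd y).continuousAt.continuousWithinAt)
      (fun y _ => (hd y).differentiableAt.differentiableWithinAt) fun y hy => ?_
    rw [interior_Icc] at hy
    rw [(hd y).deriv]
    have := deriv_drift_le hh h1 (abs_le.2 ⟨hy.1.le, hy.2.le⟩)
    norm_num
    linarith
  have := ha (abs_le.1 hs') (abs_le.1 hs) hle
  simp only at this
  have k0 := driftConst_pos
  have e : driftConst * ((s - s') ^ 3 / 4) ≤ driftConst * (s ^ 3 - s' ^ 3) := by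
    gcongr
    have : 0 ≤ (s - s') * (s + s') ^ 2 := mul_nonneg (by linarith) (sq_nonneg _)
    nlinarith
  linarith

/-! ### One step of the dynamics as an operator on observables -/

/-- The sum of all spins. -/
def mag {n : ℕ} (σ : Config (Fin n)) : ℝ := ∑ v, spin σ v

/-- The probability that an updated spin becomes `1` when the other spins add up to `x`. -/
noncomputable def plusProb (n : ℕ) (x : ℝ) : ℝ := (1 + tanh (x / n)) / 2

/-- The action `f ↦ E_σ[f(X₁)]` of one step of the critical dynamics on observables, with the
conditional law of the updated spin made explicit. -/
noncomputable def step (n : ℕ) (f : Config (Fin n) → ℝ) (σ : Config (Fin n)) : ℝ :=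
  1 / n * ∑ v, (plusProb n (mag σ - spin σ v) * f (Function.update σ v 1) +
    (1 - plusProb n (mag σ - spin σ v)) * f (Function.update σ v (-1)))

lemma plusProb_pos (x : ℝ) : 0 < plusProb n x := by
  unfold plusProb; linarith [neg_one_lt_tanh (x / n)]

lemma plusProb_lt_one (x : ℝ) : plusProb n x < 1 := by
  unfold plusProb; linarith [tanh_lt_one (x / n)]

lemma spin_eq_one_or (σ : Config (Fin n)) (v : Fin n) : spin σ v = 1 ∨ spin σ v = -1 := by
  rcases Int.units_eq_one_or (σ v) with h | h <;> simp [spin, h]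

lemma spin_sq (σ : Config (Fin n)) (v : Fin n) : spin σ v ^ 2 = 1 := by
  rcases spin_eq_one_or σ v with h | h <;> simp [h]

lemma mag_update (σ : Config (Fin n)) (v : Fin n) (s : ℤˣ) :
    mag (Function.update σ v s) = mag σ - spin σ v + ((s : ℤ) : ℝ) := by
  unfold mag
  rw [← Finset.add_sum_erase _ _ (mem_univ v), ← Finset.add_sum_erase univ (spin σ) (mem_univ v)]
  have : ∑ w ∈ univ.erase v, spin (Function.update σ v s) w = ∑ w ∈ univ.erase v, spin σ w := by
    refine Finset.sum_congr rfl fun w hw => ?_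
    simp [spin, Function.update_of_ne (Finset.ne_of_mem_erase hw)]
  rw [this]
  simp [spin]
  ring

lemma sum_mul_sum_Ioi (a : Fin n → ℝ) :
    2 * ∑ i, ∑ j ∈ Ioi i, a i * a j = (∑ i, a i) ^ 2 - ∑ i, a i ^ 2 := by
  have h1 : (∑ i, a i) ^ 2 = ∑ i, ∑ j, a i * a j := by
    rw [sq, Finset.sum_mul_sum]
  have h2 : ∀ i, ∑ j, a i * a j =
      ∑ j ∈ Ioi i, a i * a j + a i ^ 2 + ∑ j ∈ Iio i, a i * a j := fun i => by
    have hd : Disjoint (Ioi i) (Iio i) := by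
      rw [Finset.disjoint_left]; intro x hx hy
      exact lt_asymm (mem_Ioi.1 hx) (mem_Iio.1 hy)
    have : (univ : Finset (Fin n)) = insert i (Ioi i ∪ Iio i) := by
      ext j
      simp only [mem_univ, mem_insert, mem_union, mem_Ioi, mem_Iio, true_iff]
      rcases lt_trichotomy i j with h | h | h <;> simp [h]
    rw [this, sum_insert (by simp), sum_union hd]
    ring
  have h3 : ∑ i, ∑ j ∈ Iio i, a i * a j = ∑ i, ∑ j ∈ Ioi i, a i * a j := by
    rw [Finset.sum_comm' (t' := univ) (s' := fun j => Ioi j) (by simp)]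
    exact sum_congr rfl fun i _ => sum_congr rfl fun j _ => mul_comm _ _
  rw [h1, sum_congr rfl fun i _ => h2 i, sum_add_distrib, sum_add_distrib, h3]
  ring

lemma weight_eq (σ : Config (Fin n)) :
    weight n 1 σ = exp ((mag σ ^ 2 - n) / (2 * n)) := by
  unfold weight
  have h := sum_mul_sum_Ioi (spin σ)
  simp only [spin_sq, sum_const, card_univ, Fintype.card_fin, nsmul_eq_mul, mul_one] at h
  congr 1
  have : ∑ i, ∑ j ∈ Ioi i, spin σ i * spin σ j = (mag σ ^ 2 - n) / 2 := by
    unfold mag; linarith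
  rw [this, mul_comm (2 : ℝ), div_mul_div_comm, one_mul, mul_comm (n : ℝ)]

lemma weight_pos (σ : Config (Fin n)) : 0 < weight n 1 σ := exp_pos _

lemma partitionFunction_pos : 0 < partitionFunction n 1 :=
  sum_pos (fun σ _ => weight_pos σ) univ_nonempty

lemma gibbs_pos (σ : Config (Fin n)) : 0 < gibbs n 1 σ :=
  div_pos (weight_pos σ) partitionFunction_pos

lemma sum_gibbs : ∑ σ, gibbs n 1 σ = 1 := by
  unfold gibbs
  rw [← sum_div]
  exact div_self partitionFunction_pos.ne'

lemma agreeOff_eq (σ : Config (Fin n)) (v : Fin n) :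
    agreeOff σ v = {Function.update σ v 1, Function.update σ v (-1)} := by
  ext η
  simp only [agreeOff, mem_filter, mem_univ, true_and, mem_insert, mem_singleton]
  constructor
  · intro h
    rcases Int.units_eq_one_or (η v) with h1 | h1
    · left; rw [Function.eq_update_iff]; exact ⟨h1, h⟩
    · right; rw [Function.eq_update_iff]; exact ⟨h1, h⟩
  · rintro (h | h) <;> rw [Function.eq_update_iff] at h <;> exact h.2

lemma update_one_ne (σ : Config (Fin n)) (v : Fin n) :
    Function.update σ v 1 ≠ Function.update σ v (-1) := by
  intro h
  have := congrFun h v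
  simp at this

/-- The heat-bath probability of a plus spin is a logistic function of the local field. -/
lemma gibbs_cond (hn : 1 ≤ n) (σ : Config (Fin n)) (v : Fin n) :
    gibbs n 1 (Function.update σ v 1) / (gibbs n 1 (Function.update σ v 1) +
      gibbs n 1 (Function.update σ v (-1))) = plusProb n (mag σ - spin σ v) := by
  have hZ := (partitionFunction_pos (n := n)).ne'
  have hn' : (n : ℝ) ≠ 0 := by positivity
  unfold gibbs
  rw [← add_div, div_div_div_cancel_right₀ hZ, weight_eq, weight_eq, mag_update, mag_update]
  set L := mag σ - spin σ v
  have e1 : ((L + (((1 : ℤˣ) : ℤ) : ℝ)) ^ 2 - n) / (2 * n) =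
      (L ^ 2 + 1 - n) / (2 * n) + L / n := by
    push_cast; field_simp; ring
  have e2 : ((L + (((-1 : ℤˣ) : ℤ) : ℝ)) ^ 2 - n) / (2 * n) =
      (L ^ 2 + 1 - n) / (2 * n) + -(L / n) := by
    push_cast; field_simp; ring
  rw [e1, e2, exp_add, exp_add, ← mul_add, mul_div_mul_left _ _ (exp_pos _).ne']
  unfold plusProb
  rw [tanh_eq_sinh_div_cosh, sinh_eq, cosh_eq]
  have := exp_pos (L / n)
  have := exp_pos (-(L / n))
  field_simp
  ring

lemma sum_glauber_mul (hn : 1 ≤ n) (f : Config (Fin n) → ℝ) (σ : Config (Fin n)) :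
    ∑ η, glauber (gibbs n 1) σ η * f η = step n f σ := by
  unfold glauber step
  simp only [Matrix.of_apply, Fintype.card_fin, sum_mul]
  rw [sum_comm, mul_sum]
  refine sum_congr rfl fun v _ => ?_
  have hs : ∑ ξ ∈ agreeOff σ v, gibbs n 1 ξ = gibbs n 1 (Function.update σ v 1) +
      gibbs n 1 (Function.update σ v (-1)) := by
    rw [agreeOff_eq, sum_pair (update_one_ne σ v)]
  have hp : 0 < gibbs n 1 (Function.update σ v 1) + gibbs n 1 (Function.update σ v (-1)) :=
    add_pos (gibbs_pos _) (gibbs_pos _)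
  have hc := gibbs_cond hn σ v
  have hc' : gibbs n 1 (Function.update σ v (-1)) / (gibbs n 1 (Function.update σ v 1) +
      gibbs n 1 (Function.update σ v (-1))) = 1 - plusProb n (mag σ - spin σ v) := by
    rw [← hc]; field_simp; ring
  simp only [hs, mul_assoc, ← mul_sum, ite_mul, zero_mul]
  rw [sum_ite_mem, univ_inter, agreeOff_eq, sum_pair (update_one_ne σ v), hc, hc']

lemma law_apply (hn : 1 ≤ n) (t : ℕ) (f : Config (Fin n) → ℝ) (σ : Config (Fin n)) :
    ∑ η, law n 1 t σ η * f η = ((step n)^[t] f) σ := by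
  unfold law
  induction t generalizing f with
  | zero => simp [Matrix.one_apply]
  | succ t ih =>
    rw [Function.iterate_succ_apply, ← ih, pow_succ]
    simp only [Matrix.mul_apply, sum_mul, ← sum_glauber_mul hn, mul_sum]
    rw [sum_comm]
    refine sum_congr rfl fun _ _ => sum_congr rfl fun _ _ => by ring

lemma mem_agreeOff_comm (σ η : Config (Fin n)) (v : Fin n) :
    η ∈ agreeOff σ v ↔ σ ∈ agreeOff η v := by
  simp only [agreeOff, mem_filter, mem_univ, true_and]
  exact ⟨fun h w hw => (h w hw).symm, fun h w hw => (h w hw).symm⟩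

lemma agreeOff_congr {σ η : Config (Fin n)} {v : Fin n} (h : η ∈ agreeOff σ v) :
    agreeOff σ v = agreeOff η v := by
  simp only [agreeOff, mem_filter, mem_univ, true_and] at h
  ext ξ
  simp only [agreeOff, mem_filter, mem_univ, true_and]
  exact forall₂_congr fun w hw => by rw [h w hw]

/-- Detailed balance for the Gibbs measure. -/
lemma gibbs_mul_glauber_comm (σ η : Config (Fin n)) :
    gibbs n 1 σ * glauber (gibbs n 1) σ η = gibbs n 1 η * glauber (gibbs n 1) η σ := by
  unfold glauber
  simp only [Matrix.of_apply, mul_sum]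
  refine sum_congr rfl fun v _ => ?_
  by_cases h : η ∈ agreeOff σ v
  · rw [if_pos h, if_pos ((mem_agreeOff_comm σ η v).1 h), agreeOff_congr h]
    ring
  · rw [if_neg h, if_neg fun h' => h ((mem_agreeOff_comm σ η v).2 h')]
    ring

lemma step_const (hn : 1 ≤ n) (c : ℝ) : step n (fun _ => c) = fun _ => c := by
  funext σ
  have hn' : (n : ℝ) ≠ 0 := by positivity
  unfold step
  simp only [← add_mul, add_sub_cancel, one_mul, sum_const, card_univ, Fintype.card_fin,
    nsmul_eq_mul]
  field_simp

lemma step_mono {f g : Config (Fin n) → ℝ} (h : f ≤ g) : step n f ≤ step n g := by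
  intro σ
  unfold step
  gcongr with v _
  · exact (plusProb_pos _).le
  · exact h _
  · exact sub_nonneg.2 (plusProb_lt_one _).le
  · exact h _

lemma step_sub (f g : Config (Fin n) → ℝ) : step n (f - g) = step n f - step n g := by
  funext σ
  simp only [step, Pi.sub_apply, ← mul_sub, ← sum_sub_distrib]
  congr 1
  refine sum_congr rfl fun v _ => by ring

lemma iterate_step_mono (t : ℕ) {f g : Config (Fin n) → ℝ} (h : f ≤ g) :
    (step n)^[t] f ≤ (step n)^[t] g := by
  induction t generalizing f g with
  | zero => exact h
  | succ t ih => exact ih (step_mono h)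

lemma iterate_step_const (hn : 1 ≤ n) (t : ℕ) (c : ℝ) :
    (step n)^[t] (fun _ => c) = fun _ => c :=
  Function.iterate_fixed (step_const hn c) t

lemma iterate_step_sub (t : ℕ) (f g : Config (Fin n) → ℝ) :
    (step n)^[t] (f - g) = (step n)^[t] f - (step n)^[t] g := by
  induction t generalizing f g with
  | zero => rfl
  | succ t ih => rw [Function.iterate_succ_apply, step_sub, ih]; rfl

lemma abs_iterate_step_le (hn : 1 ≤ n) (t : ℕ) {f : Config (Fin n) → ℝ} {c : ℝ}
    (h : ∀ σ, |f σ| ≤ c) (σ : Config (Fin n)) : |((step n)^[t] f) σ| ≤ c := by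
  rw [abs_le]
  constructor
  · have := iterate_step_mono t (f := fun _ => -c) (g := f) (fun σ => (abs_le.1 (h σ)).1) σ
    rwa [iterate_step_const hn] at this
  · have := iterate_step_mono t (f := f) (g := fun _ => c) (fun σ => (abs_le.1 (h σ)).2) σ
    rwa [iterate_step_const hn] at this

/-- The Gibbs measure is stationary. -/
lemma sum_gibbs_mul_step (hn : 1 ≤ n) (f : Config (Fin n) → ℝ) :
    ∑ σ, gibbs n 1 σ * step n f σ = ∑ σ, gibbs n 1 σ * f σ := by
  have h1 : ∀ η, ∑ σ, glauber (gibbs n 1) η σ = 1 := fun η => by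
    have := sum_glauber_mul hn (fun _ => 1) η
    simpa [step_const hn] using this
  simp only [← sum_glauber_mul hn, mul_sum]
  rw [sum_comm]
  refine sum_congr rfl fun η _ => ?_
  calc ∑ σ, gibbs n 1 σ * (glauber (gibbs n 1) σ η * f η)
      = ∑ σ, gibbs n 1 η * f η * glauber (gibbs n 1) η σ :=
        sum_congr rfl fun σ _ => by rw [← mul_assoc, gibbs_mul_glauber_comm]; ring
    _ = _ := by rw [← mul_sum, h1, mul_one]

lemma sum_gibbs_mul_iterate_step (hn : 1 ≤ n) (t : ℕ) (f : Config (Fin n) → ℝ) :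
    ∑ σ, gibbs n 1 σ * ((step n)^[t] f) σ = ∑ σ, gibbs n 1 σ * f σ := by
  induction t generalizing f with
  | zero => rfl
  | succ t ih => rw [Function.iterate_succ_apply, ih, sum_gibbs_mul_step hn]

lemma mag_neg (σ : Config (Fin n)) : mag (-σ) = -mag σ := by
  simp [mag, spin]

lemma gibbs_neg (σ : Config (Fin n)) : gibbs n 1 (-σ) = gibbs n 1 σ := by
  unfold gibbs; rw [weight_eq, weight_eq, mag_neg, neg_sq]

/-- Odd observables have mean zero under the Gibbs measure. -/
lemma sum_gibbs_mul_eq_zero {f : Config (Fin n) → ℝ} (hf : ∀ σ, f (-σ) = -f σ) :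
    ∑ σ, gibbs n 1 σ * f σ = 0 := by
  have h : ∑ σ, gibbs n 1 σ * f σ = ∑ σ, gibbs n 1 (-σ) * f (-σ) :=
    (Equiv.sum_comp (Equiv.neg (Config (Fin n))) fun σ => gibbs n 1 σ * f σ).symm
  simp only [gibbs_neg, hf, mul_neg, sum_neg_distrib] at h
  linarith

/-! ### Total variation distance and observables -/

lemma sum_sub_mul_le_tvDist {Ω : Type*} [Fintype Ω] (μ ν f : Ω → ℝ) (hf : ∀ x, |f x| ≤ 1) :
    ∑ x, μ x * f x - ∑ x, ν x * f x ≤ 2 * tvDist μ ν := by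
  unfold tvDist
  rw [show ∀ S : ℝ, 2 * (1 / 2 * S) = S from fun S => by ring, ← sum_sub_distrib]
  refine sum_le_sum fun x _ => ?_
  rw [← sub_mul]
  refine (le_abs_self _).trans ?_
  rw [abs_mul]
  exact mul_le_of_le_one_right (abs_nonneg _) (hf x)

lemma exists_tvDist_eq {Ω : Type*} [Fintype Ω] (μ ν : Ω → ℝ) :
    ∃ f : Ω → ℝ, (∀ x, |f x| ≤ 1) ∧
      2 * tvDist μ ν = ∑ x, μ x * f x - ∑ x, ν x * f x := by
  refine ⟨fun x => if 0 ≤ μ x - ν x then 1 else -1, fun x => ?_, ?_⟩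
  · dsimp only; split_ifs <;> simp
  · unfold tvDist
    rw [show ∀ S : ℝ, 2 * (1 / 2 * S) = S from fun S => by ring, ← sum_sub_distrib]
    refine sum_congr rfl fun x _ => ?_
    dsimp only
    split_ifs with h
    · rw [abs_of_nonneg (by linarith)]; ring
    · rw [abs_of_neg (by linarith)]; ring

/-- If no observable with values in `[-1, 1]` has oscillation more than `1 / 2` after `t` steps,
then the chain is within `1 / 4` of stationarity. -/
lemma distToStationarity_le (hn : 1 ≤ n) {t : ℕ}
    (h : ∀ f : Config (Fin n) → ℝ, (∀ σ, |f σ| ≤ 1) →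
      ∀ σ η, ((step n)^[t] f) σ - ((step n)^[t] f) η ≤ 1 / 2) :
    distToStationarity n 1 t ≤ 1 / 4 := by
  refine ciSup_le fun σ => ?_
  obtain ⟨f, hf, hfe⟩ := exists_tvDist_eq (law n 1 t σ) (gibbs n 1)
  rw [law_apply hn, ← sum_gibbs_mul_iterate_step hn t] at hfe
  have h1 : ((step n)^[t] f) σ = ∑ η, gibbs n 1 η * ((step n)^[t] f) σ := by
    rw [← sum_mul, sum_gibbs, one_mul]
  have h2 : ∑ η, gibbs n 1 η * ((step n)^[t] f) σ - ∑ η, gibbs n 1 η * ((step n)^[t] f) η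
      ≤ 1 / 2 := by
    rw [← sum_sub_distrib]
    calc _ ≤ ∑ η, gibbs n 1 η * (1 / 2) := by
          refine sum_le_sum fun η _ => ?_
          rw [← mul_sub]
          exact mul_le_mul_of_nonneg_left (h f hf σ η) (gibbs_pos η).le
      _ = 1 / 2 := by rw [← sum_mul, sum_gibbs, one_mul]
  rw [← h1, ← hfe] at h2
  linarith

lemma tvDist_le_distToStationarity (t : ℕ) (σ : Config (Fin n)) :
    tvDist (law n 1 t σ) (gibbs n 1) ≤ distToStationarity n 1 t :=
  le_ciSup (f := fun σ => tvDist (law n 1 t σ) (gibbs n 1)) (Set.finite_range _).bddAbove σ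

/-! ### The number of plus spins -/

/-- The number of plus spins, which is lumpable for the dynamics. -/
def plusCount (σ : Config (Fin n)) : ℤ := (univ.filter fun v => σ v = 1).card

/-- The probability that the number `k` of plus spins goes up in one step. -/
noncomputable def up (n : ℕ) (k : ℝ) : ℝ := (n - k) / n * plusProb n (2 * k - n + 1)

/-- The probability that the number `k` of plus spins goes down in one step. -/
noncomputable def down (n : ℕ) (k : ℝ) : ℝ := k / n * (1 - plusProb n (2 * k - n - 1))

/-- The action of one step of the birth-and-death chain followed by the number of plus spins. -/
noncomputable def countStep (n : ℕ) (φ : ℤ → ℝ) (k : ℤ) : ℝ :=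
  φ k + up n k * (φ (k + 1) - φ k) + down n k * (φ (k - 1) - φ k)

lemma sum_ite_plus (σ : Config (Fin n)) (a b : ℝ) :
    ∑ v, (if σ v = 1 then a else b) = plusCount σ * a + (n - plusCount σ) * b := by
  have h : ((univ.filter fun v => σ v = 1).card : ℝ) +
      ((univ.filter fun v => ¬ σ v = 1).card : ℝ) = n := by
    have := card_filter_add_card_filter_not (s := (univ : Finset (Fin n))) (fun v => σ v = 1)
    rw [card_univ, Fintype.card_fin] at this
    exact_mod_cast this
  rw [sum_ite, sum_const, sum_const, nsmul_eq_mul, nsmul_eq_mul]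
  simp only [plusCount, Int.cast_natCast]
  rw [← h]
  ring

lemma spin_eq_ite (σ : Config (Fin n)) (v : Fin n) :
    spin σ v = if σ v = 1 then 1 else -1 := by
  rcases Int.units_eq_one_or (σ v) with h | h <;> simp [spin, h]

lemma mag_eq (σ : Config (Fin n)) : mag σ = 2 * plusCount σ - n := by
  unfold mag
  simp only [spin_eq_ite, sum_ite_plus]
  ring

lemma plusCount_nonneg (σ : Config (Fin n)) : 0 ≤ plusCount σ := by
  unfold plusCount; positivity

lemma plusCount_le (σ : Config (Fin n)) : plusCount σ ≤ n := by
  unfold plusCount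
  have := card_le_univ (univ.filter fun v => σ v = 1)
  rw [Fintype.card_fin] at this
  exact_mod_cast this

lemma plusCount_update (σ : Config (Fin n)) (v : Fin n) (s : ℤˣ) :
    plusCount (Function.update σ v s) =
      plusCount σ - (if σ v = 1 then 1 else 0) + (if s = 1 then 1 else 0) := by
  have h := mag_update σ v s
  rw [mag_eq, mag_eq, spin_eq_ite] at h
  have h1 : (((s : ℤˣ) : ℤ) : ℝ) = 2 * (if s = 1 then 1 else 0) - 1 := by
    rcases Int.units_eq_one_or s with h | h <;> norm_num [h]
  rw [h1] at h
  have : ((plusCount (Function.update σ v s) : ℤ) : ℝ) =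
      ((plusCount σ - (if σ v = 1 then 1 else 0) + (if s = 1 then 1 else 0) : ℤ) : ℝ) := by
    push_cast
    split_ifs at h ⊢ <;> linarith
  exact_mod_cast this

lemma step_comp_plusCount (hn : 1 ≤ n) (φ : ℤ → ℝ) (σ : Config (Fin n)) :
    step n (fun σ => φ (plusCount σ)) σ = countStep n φ (plusCount σ) := by
  have hn' : (n : ℝ) ≠ 0 := by positivity
  set k := plusCount σ with hk
  have h : ∀ v, plusProb n (mag σ - spin σ v) * φ (plusCount (Function.update σ v 1)) +
      (1 - plusProb n (mag σ - spin σ v)) * φ (plusCount (Function.update σ v (-1))) =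
      if σ v = 1 then plusProb n (2 * k - n - 1) * φ k +
          (1 - plusProb n (2 * k - n - 1)) * φ (k - 1)
        else plusProb n (2 * k - n + 1) * φ (k + 1) + (1 - plusProb n (2 * k - n + 1)) * φ k := by
    intro v
    rw [plusCount_update, plusCount_update, mag_eq, spin_eq_ite, ← hk]
    have : ((-1 : ℤˣ) = 1) = False := by decide
    split_ifs <;> simp_all
  unfold step
  simp only [h, sum_ite_plus, ← hk]
  unfold countStep up down
  field_simp
  ring

lemma iterate_step_comp_plusCount (hn : 1 ≤ n) (t : ℕ) (φ : ℤ → ℝ) (σ : Config (Fin n)) :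
    ((step n)^[t] fun σ => φ (plusCount σ)) σ = ((countStep n)^[t] φ) (plusCount σ) := by
  induction t generalizing φ with
  | zero => rfl
  | succ t ih =>
    rw [Function.iterate_succ_apply, Function.iterate_succ_apply, ← ih]
    have h : step n (fun σ => φ (plusCount σ)) = fun σ => countStep n φ (plusCount σ) :=
      funext fun η => step_comp_plusCount hn φ η
    rw [h]

lemma up_sub_down (hn : 1 ≤ n) (k : ℝ) :
    up n k - down n k = drift (1 / n) ((2 * k - n) / n) / 2 := by
  have hn' : (n : ℝ) ≠ 0 := by positivity
  have e1 : (2 * k - n) / n + 1 / n = (2 * k - n + 1) / n := by rw [add_div]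
  have e2 : (2 * k - n) / n - 1 / n = (2 * k - n - 1) / n := by rw [sub_div (2 * k - n)]
  unfold up down drift plusProb
  rw [e1, e2]
  field_simp
  ring

lemma up_nonneg {k : ℝ} (hk : k ≤ n) : 0 ≤ up n k :=
  mul_nonneg (div_nonneg (by linarith) (by positivity)) (plusProb_pos _).le

lemma down_nonneg {k : ℝ} (hk : 0 ≤ k) : 0 ≤ down n k :=
  mul_nonneg (div_nonneg hk (by positivity))
    (by linarith [plusProb_lt_one (n := n) (2 * k - n - 1)])

lemma down_eq_up (k : ℝ) : down n k = up n (n - k) := by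
  unfold up down plusProb
  rw [show (2 * (n - k) - n + 1 : ℝ) / n = -((2 * k - n - 1) / n) by ring, tanh_neg]
  ring

/-! ### The lower bound -/

/-- The odd `C¹` cutoff function equal to `u (3 - u²) / 2` on `[-1, 1]` and constant outside. -/
noncomputable def cutoff (u : ℝ) : ℝ :=
  max (-1) (min 1 u) * (3 - max (-1) (min 1 u) ^ 2) / 2

/-- The derivative of `cutoff`. -/
noncomputable def cutoffDeriv (u : ℝ) : ℝ := 3 / 2 * (1 - max (-1) (min 1 u) ^ 2)

lemma clamp_cases (u : ℝ) : (u ≤ -1 ∧ max (-1) (min 1 u) = -1) ∨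
    (-1 ≤ u ∧ u ≤ 1 ∧ max (-1) (min 1 u) = u) ∨ (1 ≤ u ∧ max (-1) (min 1 u) = 1) := by
  rcases le_total u (-1) with h | h
  · left; exact ⟨h, by rw [min_eq_right (by linarith), max_eq_left h]⟩
  · rcases le_total u 1 with h' | h'
    · right; left; exact ⟨h, h', by rw [min_eq_right h', max_eq_right h]⟩
    · right; right; exact ⟨h', by rw [min_eq_left h']; norm_num⟩

lemma cutoff_of_one_le {u : ℝ} (hu : 1 ≤ u) : cutoff u = 1 := by
  unfold cutoff; rw [min_eq_left hu]; norm_num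

lemma cutoff_neg (u : ℝ) : cutoff (-u) = -cutoff u := by
  have : max (-1) (min 1 (-u)) = -max (-1) (min 1 u) := by
    rcases clamp_cases u with ⟨h, e⟩ | ⟨h, h', e⟩ | ⟨h, e⟩ <;>
    rcases clamp_cases (-u) with ⟨k, f⟩ | ⟨k, k', f⟩ | ⟨k, f⟩ <;> rw [e, f] <;> linarith
  unfold cutoff; rw [this]; ring

lemma abs_cutoff_le (u : ℝ) : |cutoff u| ≤ 1 := by
  unfold cutoff
  rcases clamp_cases u with ⟨h, e⟩ | ⟨h, h', e⟩ | ⟨h, e⟩ <;> rw [e, abs_le]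
  · norm_num
  · constructor
    · nlinarith [mul_nonneg (sq_nonneg (u + 1)) (by linarith : 0 ≤ 2 - u)]
    · nlinarith [mul_nonneg (sq_nonneg (u - 1)) (by linarith : 0 ≤ 2 + u)]
  · norm_num

lemma cutoffDeriv_eq_zero {u : ℝ} (hu : 1 ≤ |u|) : cutoffDeriv u = 0 := by
  unfold cutoffDeriv
  rcases clamp_cases u with ⟨h, e⟩ | ⟨h, h', e⟩ | ⟨h, e⟩ <;> rw [e]
  · norm_num
  · have : |u| ≤ 1 := abs_le.2 ⟨h, h'⟩
    rw [← sq_abs, le_antisymm this hu]; norm_num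
  · norm_num

lemma abs_cutoffDeriv_le (u : ℝ) : |cutoffDeriv u| ≤ 3 / 2 := by
  unfold cutoffDeriv
  rcases clamp_cases u with ⟨h, e⟩ | ⟨h, h', e⟩ | ⟨h, e⟩ <;> rw [e, abs_le]
  · norm_num
  · constructor <;> nlinarith
  · norm_num

/-- The second-order Taylor bound for `cutoff`, whose second derivative is at least `-3`. -/
lemma cutoff_add_ge (u e : ℝ) :
    cutoffDeriv u * e - 3 / 2 * e ^ 2 ≤ cutoff (u + e) - cutoff u := by
  have hb := abs_le.1 (abs_cutoff_le (u + e))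
  have key : ∀ b : ℝ, cutoff b = max (-1) (min 1 b) * (3 - max (-1) (min 1 b) ^ 2) / 2 :=
    fun _ => rfl
  rw [key u]
  unfold cutoffDeriv
  rcases clamp_cases u with ⟨h, a⟩ | ⟨h, h', a⟩ | ⟨h, a⟩ <;> rw [a]
  · nlinarith [sq_nonneg e]
  · rw [key (u + e)]
    rcases clamp_cases (u + e) with ⟨k, b⟩ | ⟨k, k', b⟩ | ⟨k, b⟩ <;> rw [b]
    · -- with `d = 1 + u` and `x = -e ≥ d` the claim is monotone in `x`
      have hd : 0 ≤ 1 + u := by linarith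
      have hx : 0 ≤ -e - (1 + u) := by linarith
      nlinarith [mul_nonneg hx hd, mul_nonneg (mul_nonneg hx hd) (by linarith : 0 ≤ 1 - u),
        sq_nonneg (-e - (1 + u)), mul_nonneg (sq_nonneg (1 + u)) (by linarith : 0 ≤ 1 - u)]
    · nlinarith [mul_nonneg (sq_nonneg e) (by linarith : 0 ≤ 3 - 2 * u - (u + e))]
    · -- with `d = 1 - u ≤ e` the claim is monotone in `e`
      have hd : 0 ≤ 1 - u := by linarith
      have hx : 0 ≤ e - (1 - u) := by linarith
      nlinarith [mul_nonneg hx hd, mul_nonneg (mul_nonneg hx hd) hd,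
        sq_nonneg (e - (1 - u)), pow_nonneg hd 3]
  · rw [key (u + e)]
    rcases clamp_cases (u + e) with ⟨k, b⟩ | ⟨k, k', b⟩ | ⟨k, b⟩ <;> rw [b]
    · nlinarith
    · have h1 : 0 ≤ 1 - (u + e) := by linarith
      have h2 : (1 - (u + e)) ^ 2 ≤ e ^ 2 := by
        rw [← neg_sq e]; exact pow_le_pow_left₀ h1 (by linarith) 2
      nlinarith [mul_nonneg (sq_nonneg (1 - (u + e))) h1]
    · nlinarith [sq_nonneg e]

lemma up_add_down_le {k : ℝ} (hn : 1 ≤ n) (h0 : 0 ≤ k) (hk : k ≤ n) :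
    up n k + down n k ≤ 1 := by
  have hn' : (0 : ℝ) < n := by positivity
  have h1 : up n k ≤ (n - k) / n :=
    mul_le_of_le_one_right (div_nonneg (by linarith) hn'.le) (plusProb_lt_one _).le
  have h2 : down n k ≤ k / n :=
    mul_le_of_le_one_right (div_nonneg h0 hn'.le)
      (by linarith [plusProb_pos (n := n) (2 * k - n - 1)])
  have : ((n : ℝ) - k) / n + k / n = 1 := by field_simp; ring
  linarith

/-- The length scale `n ^ (3 / 4)` of the critical fluctuations of the magnetization. -/
noncomputable def scale (n : ℕ) : ℝ := (n : ℝ) ^ (3 / 4 : ℝ)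

lemma scale_sq : scale n ^ 2 = (n : ℝ) ^ (3 / 2 : ℝ) := by
  unfold scale
  rw [← rpow_natCast, ← rpow_mul (by positivity)]; norm_num

lemma scale_pow_four : scale n ^ 4 = (n : ℝ) ^ 3 := by
  unfold scale
  rw [← rpow_natCast, ← rpow_mul (by positivity), ← rpow_natCast]; norm_num

lemma one_le_scale (hn : 1 ≤ n) : 1 ≤ scale n :=
  one_le_rpow (by exact_mod_cast hn) (by norm_num)

lemma scale_le (hn : 1 ≤ n) : scale n ≤ n := by
  have : (1 : ℝ) ≤ n := by exact_mod_cast hn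
  calc scale n ≤ (n : ℝ) ^ (1 : ℝ) := rpow_le_rpow_of_exponent_le this (by norm_num)
    _ = n := rpow_one _

/-- In the critical window the drift of the magnetization over one step is of the order of the
inverse of its typical size. -/
lemma abs_drift_le_of_window (hn : 1 ≤ n) {m : ℝ} (hm : |m| ≤ scale n) :
    |drift (1 / n) (m / n)| ≤ 9 / scale n := by
  set A := scale n with hA
  have hA1 := one_le_scale hn
  have hAn := scale_le hn
  have hA4 := scale_pow_four (n := n)
  rw [← hA] at hA1 hAn hA4
  have hn0 : (0 : ℝ) < n := by positivity
  have hA0 : 0 < A := by linarith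
  have hs : |m / n| ≤ A / n := by
    rw [abs_div, abs_of_pos hn0]; gcongr
  have hs1 : |m / n| ≤ 1 := hs.trans (by rw [div_le_one hn0]; exact hAn)
  refine (abs_drift_le (by positivity) hs1).trans ?_
  have h1 : 1 / (n : ℝ) ≤ A / n := by gcongr
  have hc : (A / n) ^ 3 = 1 / A := by
    rw [div_pow, ← hA4]; field_simp
  have hsq : A / n * (1 / n) ≤ 1 / A := by
    rw [div_mul_div_comm, mul_one, div_le_div_iff₀ (by positivity) hA0, one_mul, ← sq, ← sq]
    gcongr
  calc |m / n| * (1 / n) + (|m / n| + 1 / n) ^ 3 ≤ A / n * (1 / n) + (A / n + A / n) ^ 3 := by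
        gcongr
    _ = A / n * (1 / n) + 8 * (A / n) ^ 3 := by ring
    _ ≤ 1 / A + 8 * (1 / A) := by rw [hc]; gcongr
    _ = 9 / A := by ring

/-- The rescaled and truncated magnetization loses at most a multiple of `n ^ (-3 / 2)` per step
in expectation, uniformly over all configurations. -/
lemma step_cutoff_ge (hn : 1 ≤ n) (σ : Config (Fin n)) :
    cutoff (mag σ / scale n) - 20 / scale n ^ 2 ≤
      step n (fun σ => cutoff (mag σ / scale n)) σ := by
  set A := scale n with hA
  have hA1 := one_le_scale hn
  rw [← hA] at hA1
  have hA0 : 0 < A := by linarith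
  have hk0 : (0 : ℝ) ≤ plusCount σ := by exact_mod_cast plusCount_nonneg σ
  have hkn : (plusCount σ : ℝ) ≤ n := by exact_mod_cast plusCount_le σ
  have e := step_comp_plusCount hn (fun k => cutoff ((2 * k - n) / A)) σ
  simp only [← mag_eq] at e
  rw [e]
  unfold countStep
  dsimp only
  rw [← mag_eq]
  set u := mag σ / A with hu
  have e1 : (2 * ((plusCount σ + 1 : ℤ) : ℝ) - n) / A = u + 2 / A := by
    rw [hu, mag_eq]; push_cast; ring
  have e2 : (2 * ((plusCount σ - 1 : ℤ) : ℝ) - n) / A = u + -(2 / A) := by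
    rw [hu, mag_eq]; push_cast; ring
  rw [e1, e2]
  have U0 := up_nonneg hkn
  have D0 := down_nonneg (n := n) hk0
  have UD := up_add_down_le hn hk0 hkn
  have t1 := mul_le_mul_of_nonneg_left (cutoff_add_ge u (2 / A)) U0
  have t2 := mul_le_mul_of_nonneg_left (cutoff_add_ge u (-(2 / A))) D0
  have d := up_sub_down hn (plusCount σ : ℝ)
  rw [← mag_eq] at d
  have q : 3 / 2 * (2 / A) ^ 2 * (up n (plusCount σ) + down n (plusCount σ)) ≤ 6 / A ^ 2 := by
    calc _ ≤ 3 / 2 * (2 / A) ^ 2 * 1 := by gcongr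
      _ = 6 / A ^ 2 := by ring
  have r : -(14 / A ^ 2) ≤
      cutoffDeriv u * (2 / A) * (up n (plusCount σ) - down n (plusCount σ)) := by
    rw [d]
    rcases le_total 1 |u| with h | h
    · rw [cutoffDeriv_eq_zero h, zero_mul, zero_mul, neg_nonpos]; positivity
    · have hm : |mag σ| ≤ A := by
        rw [hu, abs_div, abs_of_pos hA0, div_le_one hA0] at h; exact h
      have hw := abs_drift_le_of_window hn hm
      refine (abs_le.1 ?_).1
      rw [abs_mul, abs_mul, abs_div (drift _ _), abs_of_pos (by positivity : 0 < 2 / A),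
        abs_of_pos (by norm_num : (0 : ℝ) < 2)]
      calc _ ≤ 3 / 2 * (2 / A) * (9 / A / 2) := by
            gcongr
            exact abs_cutoffDeriv_le u
        _ = 27 / 2 / A ^ 2 := by ring
        _ ≤ 14 / A ^ 2 := by gcongr; norm_num
  have : 20 / A ^ 2 = 14 / A ^ 2 + 6 / A ^ 2 := by ring
  nlinarith

lemma iterate_step_ge (hn : 1 ≤ n) {f : Config (Fin n) → ℝ} {ε : ℝ}
    (h : ∀ σ, f σ - ε ≤ step n f σ) (t : ℕ) (σ : Config (Fin n)) :
    f σ - t * ε ≤ ((step n)^[t] f) σ := by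
  induction t generalizing σ with
  | zero => simp
  | succ t ih =>
    have h1 := iterate_step_mono t (f := f - fun _ => ε) (g := step n f) h σ
    rw [iterate_step_sub, iterate_step_const hn] at h1
    rw [Function.iterate_succ_apply]
    simp only [Pi.sub_apply] at h1
    push_cast
    linarith [ih σ]

/-- Started from the all-plus configuration, the truncated magnetization stays close to `1` for
a time of order `n ^ (3 / 2)`, while its Gibbs mean vanishes by symmetry. -/
lemma le_of_distToStationarity_le (hn : 1 ≤ n) {t : ℕ}
    (ht : distToStationarity n 1 t ≤ 1 / 4) : 1 / 40 * (n : ℝ) ^ (3 / 2 : ℝ) ≤ t := by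
  set f : Config (Fin n) → ℝ := fun σ => cutoff (mag σ / scale n)
  have hs := iterate_step_ge hn (step_cutoff_ge hn) t (1 : Config (Fin n))
  have hm : mag (1 : Config (Fin n)) = n := by simp [mag, spin]
  have h1 : cutoff (mag (1 : Config (Fin n)) / scale n) = 1 := by
    refine cutoff_of_one_le ?_
    rw [hm, one_le_div (by linarith [one_le_scale hn])]
    exact scale_le hn
  have hz : ∑ σ, gibbs n 1 σ * f σ = 0 :=
    sum_gibbs_mul_eq_zero fun σ => by simp only [f, mag_neg, neg_div, cutoff_neg]
  have htv := sum_sub_mul_le_tvDist (law n 1 t 1) (gibbs n 1) f fun σ => abs_cutoff_le _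
  have hd := tvDist_le_distToStationarity (n := n) t 1
  rw [law_apply hn, hz] at htv
  rw [h1] at hs
  have h2 : 1 / 2 ≤ t * (20 / scale n ^ 2) := by linarith
  have hA0 : 0 < scale n ^ 2 := by have := one_le_scale hn; positivity
  rw [mul_div_assoc', le_div_iff₀ hA0] at h2
  rw [← scale_sq]
  linarith

/-! ### Forgetting everything but the number of plus spins -/

lemma mag_comp (σ : Config (Fin n)) (τ : Equiv.Perm (Fin n)) : mag (σ ∘ τ) = mag σ :=
  Equiv.sum_comp τ (spin σ)

/-- The dynamics commutes with permutations of the vertices. -/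
lemma step_comp_perm (f : Config (Fin n) → ℝ) (τ : Equiv.Perm (Fin n)) (σ : Config (Fin n)) :
    step n f (σ ∘ τ) = step n (fun η => f (η ∘ τ)) σ := by
  unfold step
  congr 1
  refine Eq.trans ?_ (Equiv.sum_comp τ _)
  refine sum_congr rfl fun v _ => ?_
  have h : ∀ s : ℤˣ, Function.update (σ ∘ τ) v s = Function.update σ (τ v) s ∘ τ := fun s => by
    rw [Function.update_comp_equiv]; simp
  rw [mag_comp, h, h]
  rfl

/-- A lower bound, uniform in the configuration, for the probability that an updated spin takes
a prescribed value. -/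
noncomputable def flipConst : ℝ := (1 - tanh 1) / 2

lemma flipConst_pos : 0 < flipConst := by
  unfold flipConst; linarith [tanh_lt_one 1]

lemma flipConst_le_half : flipConst ≤ 1 / 2 := by
  unfold flipConst; linarith [tanh_nonneg (x := 1) (by norm_num)]

lemma flipConst_le_plusProb {x : ℝ} (hn : 1 ≤ n) (hx : |x| ≤ n) :
    flipConst ≤ plusProb n x ∧ flipConst ≤ 1 - plusProb n x := by
  have hn0 : (0 : ℝ) < n := by positivity
  have h : |x / n| ≤ 1 := by rwa [abs_div, abs_of_pos hn0, div_le_one hn0]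
  rw [abs_le] at h
  have h1 := tanh_mono h.1
  have h2 := tanh_mono h.2
  rw [tanh_neg] at h1
  unfold flipConst plusProb
  constructor <;> linarith

lemma abs_mag_sub_spin_le (σ : Config (Fin n)) (v : Fin n) : |mag σ - spin σ v| ≤ n := by
  have h1 : mag σ - spin σ v = ∑ w ∈ univ.erase v, spin σ w := by
    unfold mag; rw [← add_sum_erase _ _ (mem_univ v)]; ring
  rw [h1]
  calc |∑ w ∈ univ.erase v, spin σ w| ≤ ∑ w ∈ univ.erase v, |spin σ w| := abs_sum_le_sum_abs _ _
    _ ≤ ∑ w, |spin σ w| :=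
        sum_le_sum_of_subset_of_nonneg (erase_subset _ _) fun _ _ _ => abs_nonneg _
    _ = n := by
        have : ∀ w, |spin σ w| = 1 := fun w => by
          rcases spin_eq_one_or σ w with h | h <;> simp [h]
        simp [this]

lemma comp_swap_of_eq {σ : Config (Fin n)} {i j : Fin n} (h : σ i = σ j) :
    σ ∘ Equiv.swap i j = σ := by
  funext v
  simp only [Function.comp_apply]
  rcases eq_or_ne v i with rfl | hi
  · rw [Equiv.swap_apply_left, h]
  · rcases eq_or_ne v j with rfl | hj
    · rw [Equiv.swap_apply_right, h]
    · rw [Equiv.swap_apply_of_ne_of_ne hi hj]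

/-- The difference `f σ - f (σ ∘ swap i j)` vanishes where the spins at `i` and `j` agree, and
one step makes them agree with probability at least `flipConst / n`; the chains started at `σ`
and `σ ∘ swap i j` may be run as mirror images of each other until then. -/
lemma abs_step_sub_step_swap_le (hn : 1 ≤ n) {f : Config (Fin n) → ℝ} {i j : Fin n} {ω : ℝ}
    (h : ∀ σ, |f σ - f (σ ∘ Equiv.swap i j)| ≤ ω) (σ : Config (Fin n)) :
    |step n f σ - step n f (σ ∘ Equiv.swap i j)| ≤ (1 - flipConst / n) * ω := by
  have hn0 : (0 : ℝ) < n := by positivity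
  have hn1 : (1 : ℝ) ≤ n := by exact_mod_cast hn
  have hω : 0 ≤ ω := (abs_nonneg _).trans (h σ)
  have c0 := flipConst_pos
  have c1 := flipConst_le_half
  rcases eq_or_ne (σ i) (σ j) with hij | hij
  · rw [comp_swap_of_eq hij, sub_self, abs_zero]
    refine mul_nonneg ?_ hω
    rw [sub_nonneg, div_le_one hn0]
    linarith
  have hne : j ≠ i := fun e => hij (by rw [e])
  set g : Config (Fin n) → ℝ := fun η => f η - f (η ∘ Equiv.swap i j) with hg
  have hg0 : ∀ η : Config (Fin n), η i = η j → g η = 0 := fun η he => by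
    simp only [hg]; rw [comp_swap_of_eq he, sub_self]
  have hsub : step n f σ - step n f (σ ∘ Equiv.swap i j) = step n g σ := by
    rw [step_comp_perm]
    exact (congrFun (step_sub f fun η => f (η ∘ Equiv.swap i j)) σ).symm
  rw [hsub]
  set T : Fin n → ℝ := fun v => plusProb n (mag σ - spin σ v) * g (Function.update σ v 1) +
    (1 - plusProb n (mag σ - spin σ v)) * g (Function.update σ v (-1))
  have habs : ∀ v, |T v| ≤ plusProb n (mag σ - spin σ v) * |g (Function.update σ v 1)| +
      (1 - plusProb n (mag σ - spin σ v)) * |g (Function.update σ v (-1))| := fun v => by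
    refine (abs_add_le _ _).trans ?_
    rw [abs_mul, abs_mul, abs_of_pos (plusProb_pos _),
      abs_of_pos (sub_pos.2 (plusProb_lt_one _))]
  have hTv : ∀ v, |T v| ≤ ω := fun v => by
    refine (habs v).trans ?_
    have p0 := plusProb_pos (n := n) (mag σ - spin σ v)
    have p1 := plusProb_lt_one (n := n) (mag σ - spin σ v)
    nlinarith [h (Function.update σ v 1), h (Function.update σ v (-1))]
  have hTi : |T i| ≤ (1 - flipConst) * ω := by
    refine (habs i).trans ?_
    obtain ⟨p0, p1⟩ := flipConst_le_plusProb hn (abs_mag_sub_spin_le σ i)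
    rcases Int.units_eq_one_or (σ j) with hj | hj
    · rw [hg0 (Function.update σ i 1) (by simp [hne, hj]), abs_zero, mul_zero, zero_add]
      have := h (Function.update σ i (-1))
      nlinarith [abs_nonneg (g (Function.update σ i (-1)))]
    · rw [hg0 (Function.update σ i (-1)) (by simp [hne, hj]), abs_zero, mul_zero, add_zero]
      have := h (Function.update σ i 1)
      nlinarith [abs_nonneg (g (Function.update σ i 1))]
  have hsum : ∑ v, |T v| ≤ n * ω - flipConst * ω := by
    rw [← add_sum_erase _ _ (mem_univ i)]
    have : ∑ v ∈ univ.erase i, |T v| ≤ ∑ v ∈ univ.erase i, ω := sum_le_sum fun v _ => hTv v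
    rw [sum_const, card_erase_of_mem (mem_univ i), card_univ, Fintype.card_fin, nsmul_eq_mul,
      Nat.cast_sub hn] at this
    push_cast at this
    linarith
  calc |step n g σ| = 1 / n * |∑ v, T v| := by
        unfold step; rw [abs_mul, abs_of_pos (by positivity : (0 : ℝ) < 1 / n)]
    _ ≤ 1 / n * (n * ω - flipConst * ω) := by
        gcongr
        exact (abs_sum_le_sum_abs _ _).trans hsum
    _ = (1 - flipConst / n) * ω := by field_simp

lemma abs_iterate_step_sub_swap_le (hn : 1 ≤ n) {f : Config (Fin n) → ℝ}
    (hf : ∀ σ, |f σ| ≤ 1) (i j : Fin n) (t : ℕ) (σ : Config (Fin n)) :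
    |((step n)^[t] f) σ - ((step n)^[t] f) (σ ∘ Equiv.swap i j)| ≤
      2 * (1 - flipConst / n) ^ t := by
  induction t generalizing σ with
  | zero =>
    have := (abs_sub (f σ) (f (σ ∘ Equiv.swap i j)))
    simp only [Function.iterate_zero, id_eq, pow_zero, mul_one]
    linarith [hf σ, hf (σ ∘ Equiv.swap i j)]
  | succ t ih =>
    rw [Function.iterate_succ_apply']
    refine (abs_step_sub_step_swap_le hn ih σ).trans (le_of_eq ?_)
    ring

/-- Two configurations with the same number of plus spins differ by at most `n` transpositions. -/
lemma abs_sub_le_of_plusCount_eq {F : Config (Fin n) → ℝ} {ε : ℝ} (hε : 0 ≤ ε)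
    (hF : ∀ (i j : Fin n) σ, |F σ - F (σ ∘ Equiv.swap i j)| ≤ ε) (σ η : Config (Fin n))
    (h : plusCount σ = plusCount η) : |F σ - F η| ≤ n * ε := by
  have key : ∀ (d : ℕ) (σ : Config (Fin n)), plusCount σ = plusCount η →
      (univ.filter fun v => σ v ≠ η v).card ≤ d → |F σ - F η| ≤ d * ε := by
    intro d
    induction d with
    | zero =>
      intro σ _ hd
      have : σ = η := by
        funext v
        by_contra hv
        have : v ∈ univ.filter fun v => σ v ≠ η v := by simp [hv]
        rw [Finset.card_eq_zero.1 (Nat.le_zero.1 hd)] at this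
        simp at this
      simp [this]
    | succ d ih =>
      intro σ hσ hd
      by_cases he : σ = η
      · rw [he, sub_self, abs_zero]; positivity
      -- there is a vertex where only `σ` is plus, and one where only `η` is plus
      have hcard : (univ.filter fun v => σ v = 1).card = (univ.filter fun v => η v = 1).card := by
        simpa [plusCount] using hσ
      have hne : (univ.filter fun v => σ v = 1) ≠ (univ.filter fun v => η v = 1) := by
        intro hs
        apply he
        funext v
        have hv := Finset.ext_iff.1 hs v
        simp only [mem_filter, mem_univ, true_and] at hv
        rcases Int.units_eq_one_or (σ v) with a | a <;>
        rcases Int.units_eq_one_or (η v) with b | b <;> simp_all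
      obtain ⟨i, hi, hi'⟩ := Finset.not_subset.1 fun hs =>
        hne (eq_of_subset_of_card_le hs hcard.ge)
      obtain ⟨j, hj, hj'⟩ := Finset.not_subset.1 fun hs =>
        hne (eq_of_subset_of_card_le hs hcard.le).symm
      simp only [mem_filter, mem_univ, true_and] at hi hi' hj hj'
      have hηi := (Int.units_eq_one_or (η i)).resolve_left hi'
      have hσj := (Int.units_eq_one_or (σ j)).resolve_left hj'
      set ξ := σ ∘ Equiv.swap i j with hξ
      have hξη : plusCount ξ = plusCount η := by
        rw [← hσ]
        have := mag_comp σ (Equiv.swap i j)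
        rw [mag_eq, mag_eq] at this
        have h2 : ((plusCount ξ : ℤ) : ℝ) = plusCount σ := by linarith
        exact_mod_cast h2
      have hsub : (univ.filter fun v => ξ v ≠ η v) ⊂ univ.filter fun v => σ v ≠ η v := by
        refine (Finset.ssubset_iff_of_subset fun v hv => ?_).2 ⟨i, ?_, ?_⟩
        · simp only [mem_filter, mem_univ, true_and] at hv ⊢
          rcases eq_or_ne v i with rfl | hvi
          · rw [hi, hηi]; decide
          rcases eq_or_ne v j with rfl | hvj
          · rw [hj, hσj]; decide
          rwa [hξ, Function.comp_apply, Equiv.swap_apply_of_ne_of_ne hvi hvj] at hv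
        · simp only [mem_filter, mem_univ, true_and]
          rw [hi, hηi]; decide
        · simp [hξ, hσj, hηi]
      have h1 := ih ξ hξη (Nat.lt_succ_iff.1 ((card_lt_card hsub).trans_le hd))
      calc |F σ - F η| ≤ |F σ - F ξ| + |F ξ - F η| := abs_sub_le _ _ _
        _ ≤ ε + d * ε := add_le_add (hF i j σ) h1
        _ = (d + 1 : ℕ) * ε := by push_cast; ring
  refine key n σ h ((card_le_univ _).trans ?_)
  rw [Fintype.card_fin]

/-! ### Coupling two copies of the birth-and-death chain -/

/-- The action on observables of one step of a coupling of two copies of the chain of plus counts.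
Three quarters of the common jump rates are spent on simultaneous jumps in the same direction; the
remaining jumps are made by one copy at a time. Hence the copies cannot cross, and their
difference still fluctuates. -/
noncomputable def pairStep (n : ℕ) (u : ℤ → ℤ → ℝ) (k l : ℤ) : ℝ :=
  u k l + (up n k - 3 / 4 * min (up n k) (up n l)) * (u (k + 1) l - u k l)
    + (up n l - 3 / 4 * min (up n k) (up n l)) * (u k (l + 1) - u k l)
    + (down n k - 3 / 4 * min (down n k) (down n l)) * (u (k - 1) l - u k l)
    + (down n l - 3 / 4 * min (down n k) (down n l)) * (u k (l - 1) - u k l)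
    + 3 / 4 * min (up n k) (up n l) * (u (k + 1) (l + 1) - u k l)
    + 3 / 4 * min (down n k) (down n l) * (u (k - 1) (l - 1) - u k l)

lemma pairStep_sub (φ : ℤ → ℝ) (k l : ℤ) :
    pairStep n (fun k l => φ k - φ l) k l = countStep n φ k - countStep n φ l := by
  unfold pairStep countStep; ring

lemma pairStep_neg (u : ℤ → ℤ → ℝ) (k l : ℤ) :
    pairStep n (fun k l => -u k l) k l = -pairStep n u k l := by
  unfold pairStep; ring

lemma pairStep_mul (c : ℝ) (u : ℤ → ℤ → ℝ) (k l : ℤ) :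
    pairStep n (fun k l => c * u k l) k l = c * pairStep n u k l := by
  unfold pairStep; ring

lemma pairStep_const (c : ℝ) (k l : ℤ) : pairStep n (fun _ _ => c) k l = c := by
  unfold pairStep; ring

/-- Up to an error of order `1 / n`, the jump probability is at most `1 / 4`. The bound `25 / 64` is
small enough for `coupling_rate_le`, where `2 * (5 / 4) * (25 / 64) ≤ 1` is needed. -/
lemma up_le (hn : 2 ≤ n) {k : ℝ} (hk : k ≤ n) : up n k ≤ 25 / 64 := by
  have hn2 : (2 : ℝ) ≤ n := by exact_mod_cast hn
  have hn0 : (0 : ℝ) < n := by linarith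
  set h := 1 / (n : ℝ) with hh
  have h0 : 0 < h := by positivity
  have h1 : h ≤ 1 / 2 := by rw [hh]; gcongr
  set x := (2 * k - n + 1) / (n : ℝ) with hx
  have e : up n k = (1 + h - x) * (1 + tanh x) / 4 := by
    unfold up plusProb
    rw [← hx, hx, hh]
    field_simp
    ring
  have hpos : 0 ≤ 1 + h - x := by
    have : 1 + h - x = 2 * ((n - k) / n) := by rw [hx, hh]; field_simp; ring
    rw [this]
    have : 0 ≤ ((n : ℝ) - k) / n := div_nonneg (by linarith) hn0.le
    linarith
  rw [e]
  rcases le_total 0 x with h' | h'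
  · have := tanh_le_self h'
    nlinarith [sq_nonneg (x - h / 2)]
  · have t := div_one_add_le_tanh (x := -x) (by linarith)
    rw [tanh_neg] at t
    have t2 : 1 + tanh x ≤ 1 / (1 + -x) := by
      have : 1 / (1 + -x) = 1 - -x / (1 + -x) := by
        have : (1 + -x) ≠ 0 := by linarith
        field_simp; ring
      linarith
    have t3 : (1 + h - x) * (1 / (1 + -x)) ≤ 1 + h := by
      rw [mul_one_div, div_le_iff₀ (by linarith)]
      nlinarith
    nlinarith [mul_le_mul_of_nonneg_left t2 hpos]

lemma up_self : up n n = 0 := by simp [up]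

lemma down_zero : down n 0 = 0 := by simp [down]

lemma down_le (hn : 2 ≤ n) {k : ℝ} (hk : 0 ≤ k) : down n k ≤ 25 / 64 := by
  rw [down_eq_up]; exact up_le hn (by linarith)

/-- The jump probabilities of the coupling add up to at most one. -/
lemma coupling_rate_le (hn : 1 ≤ n) {k l : ℤ} (hl : 0 ≤ l) (hlk : l < k) (hk : k ≤ n) :
    up n k + up n l - 3 / 4 * min (up n k) (up n l) +
      (down n k + down n l - 3 / 4 * min (down n k) (down n l)) ≤ 1 := by
  have hl' : (0 : ℝ) ≤ l := by exact_mod_cast hl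
  have hk' : (k : ℝ) ≤ n := by exact_mod_cast hk
  have hlk' : (l : ℝ) < k := by exact_mod_cast hlk
  rcases hn.eq_or_lt with h1 | h2
  · subst h1
    obtain rfl : l = 0 := by push_cast at hk; omega
    obtain rfl : k = 1 := by push_cast at hk; omega
    norm_num [up, down, plusProb]
  · have a1 := up_le h2 hk'
    have a2 := up_le h2 (hlk'.le.trans hk')
    have b1 := down_le h2 (hl'.trans hlk'.le)
    have b2 := down_le h2 hl'
    have c1 : up n k + up n l - 3 / 4 * min (up n k) (up n l) ≤ 1 / 2 := by
      rcases min_choice (up n (k : ℝ)) (up n (l : ℝ)) with e | e <;> rw [e] <;> linarith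
    have c2 : down n k + down n l - 3 / 4 * min (down n k) (down n l) ≤ 1 / 2 := by
      rcases min_choice (down n (k : ℝ)) (down n (l : ℝ)) with e | e <;> rw [e] <;> linarith
    linarith

lemma pairStep_mono (hn : 1 ≤ n) {u v : ℤ → ℤ → ℝ}
    (h : ∀ k l : ℤ, 0 ≤ l → l ≤ k → k ≤ n → u k l ≤ v k l) {k l : ℤ}
    (hl : 0 ≤ l) (hlk : l < k) (hk : k ≤ n) : pairStep n u k l ≤ pairStep n v k l := by
  have hl' : (0 : ℝ) ≤ l := by exact_mod_cast hl
  have hk' : (k : ℝ) ≤ n := by exact_mod_cast hk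
  have hlk' : (l : ℝ) < k := by exact_mod_cast hlk
  have hr := coupling_rate_le hn hl hlk hk
  have Uk := up_nonneg hk'
  have Ul := up_nonneg (hlk'.le.trans hk')
  have Dk := down_nonneg (n := n) (hl'.trans hlk'.le)
  have Dl := down_nonneg (n := n) hl'
  have m1 : min (up n k) (up n l) ≤ up n k := min_le_left _ _
  have m2 : min (up n k) (up n l) ≤ up n l := min_le_right _ _
  have m3 : min (down n k) (down n l) ≤ down n k := min_le_left _ _
  have m4 : min (down n k) (down n l) ≤ down n l := min_le_right _ _
  have m5 : 0 ≤ min (up n k) (up n l) := le_min Uk Ul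
  have m6 : 0 ≤ min (down n k) (down n l) := le_min Dk Dl
  -- a jump leaving `{0, …, n}` has rate zero
  have hup : k = n ∨ k + 1 ≤ n := by omega
  have hdown : l = 0 ∨ 0 ≤ l - 1 := by omega
  have hUk : k = n → up n k = 0 := fun e => by rw [e]; exact_mod_cast up_self
  have hDl : l = 0 → down n l = 0 := fun e => by rw [e]; exact_mod_cast down_zero
  have aux : ∀ {c x y : ℝ}, 0 ≤ c → (c = 0 ∨ x ≤ y) → c * x ≤ c * y := by
    rintro c x y hc (rfl | hxy)
    · simp
    · exact mul_le_mul_of_nonneg_left hxy hc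
  have t0 := aux (c := 1 - (up n k + up n l - 3 / 4 * min (up n k) (up n l) +
      (down n k + down n l - 3 / 4 * min (down n k) (down n l)))) (x := u k l) (y := v k l)
    (by linarith) (Or.inr (h k l hl hlk.le hk))
  have t1 := aux (c := up n k - 3 / 4 * min (up n k) (up n l)) (x := u (k + 1) l)
    (y := v (k + 1) l) (by linarith) (by
      rcases hup with e | e
      · left
        have := hUk e
        linarith
      · exact Or.inr (h _ _ hl (by omega) e))
  have t2 := aux (c := up n l - 3 / 4 * min (up n k) (up n l)) (x := u k (l + 1))
    (y := v k (l + 1)) (by linarith) (Or.inr (h _ _ (by omega) (by omega) hk))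
  have t3 := aux (c := down n k - 3 / 4 * min (down n k) (down n l)) (x := u (k - 1) l)
    (y := v (k - 1) l) (by linarith) (Or.inr (h _ _ hl (by omega) (by omega)))
  have t4 := aux (c := down n l - 3 / 4 * min (down n k) (down n l)) (x := u k (l - 1))
    (y := v k (l - 1)) (by linarith) (by
      rcases hdown with e | e
      · left
        have := hDl e
        linarith
      · exact Or.inr (h _ _ e (by omega) hk))
  have t5 := aux (c := 3 / 4 * min (up n k) (up n l)) (x := u (k + 1) (l + 1))
    (y := v (k + 1) (l + 1)) (by linarith) (by
      rcases hup with e | e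
      · left
        have := hUk e
        linarith
      · exact Or.inr (h _ _ (by omega) (by omega) e))
  have t6 := aux (c := 3 / 4 * min (down n k) (down n l)) (x := u (k - 1) (l - 1))
    (y := v (k - 1) (l - 1)) (by linarith) (by
      rcases hdown with e | e
      · left
        have := hDl e
        linarith
      · exact Or.inr (h _ _ e (by omega) (by omega)))
  unfold pairStep
  linarith

lemma abs_pairStep_le (hn : 1 ≤ n) {u v : ℤ → ℤ → ℝ}
    (h : ∀ k l : ℤ, 0 ≤ l → l ≤ k → k ≤ n → |u k l| ≤ v k l) {k l : ℤ}
    (hl : 0 ≤ l) (hlk : l < k) (hk : k ≤ n) : |pairStep n u k l| ≤ pairStep n v k l := by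
  rw [abs_le']
  refine ⟨pairStep_mono hn (fun k l a b c => (le_abs_self _).trans (h k l a b c)) hl hlk hk, ?_⟩
  rw [← pairStep_neg]
  exact pairStep_mono hn (fun k l a b c => (neg_le_abs _).trans (h k l a b c)) hl hlk hk

lemma flipConst_le_up_add_down (hn : 1 ≤ n) {k : ℤ} (h0 : 0 ≤ k) (hk : k ≤ n) :
    flipConst ≤ up n k + down n k := by
  have hn0 : (0 : ℝ) < n := by positivity
  have h0' : (0 : ℝ) ≤ k := by exact_mod_cast h0
  have hk' : (k : ℝ) ≤ n := by exact_mod_cast hk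
  have key : ∀ j : ℤ, 0 ≤ j → j ≤ n → ((n : ℝ) - j) / n * flipConst ≤ up n j := by
    intro j j0 jn
    rcases jn.eq_or_lt with rfl | hj
    · simp [up]
    · have j1 : (j : ℝ) + 1 ≤ n := by exact_mod_cast hj
      have j0' : (0 : ℝ) ≤ j := by exact_mod_cast j0
      unfold up
      refine mul_le_mul_of_nonneg_left (flipConst_le_plusProb hn ?_).1
        (div_nonneg (by linarith) hn0.le)
      rw [abs_le]
      constructor <;> linarith
  have a := key k h0 hk
  have b := key (n - k) (by omega) (by omega)
  rw [down_eq_up]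
  push_cast at b
  have : ((n : ℝ) - k) / n * flipConst + (n - (n - k)) / n * flipConst = flipConst := by
    field_simp; ring
  linarith

/-- The concave function `D / (A + D)` of the distance decreases in expectation by a multiple of
`A⁻²` under jumps of `±1` at rates `p` and `q`: for `D ≤ A` because of the fluctuations, for
`D ≥ A` because of the drift. -/
lemma concave_step_le {A D p q c κ : ℝ} (hA : 1 ≤ A) (hD : 1 ≤ D) (hκ : 0 ≤ κ) (hc : 0 ≤ c)
    (hd : p - q ≤ -(κ / 3 * (D ^ 3 / A ^ 4))) (hs : c ≤ p + q) :
    p * ((D + 1) / (A + (D + 1)) - D / (A + D)) + q * ((D - 1) / (A + (D - 1)) - D / (A + D)) ≤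
      -(min (c / 8) (κ / 12) / A ^ 2) := by
  have hA0 : 0 < A := by linarith
  have hD0 : 0 < D := by linarith
  set B := A + D with hB
  have hB2 : 2 ≤ B := by linarith
  have hB1 : 0 < B - 1 := by linarith
  set N := (q - p) * B + (p + q) with hN
  have e : p * ((D + 1) / (A + (D + 1)) - D / B) + q * ((D - 1) / (A + (D - 1)) - D / B) =
      -(A * N / (B * ((B - 1) * (B + 1)))) := by
    have e1 : A + (D + 1) = B + 1 := by rw [hB]; ring
    have e2 : A + (D - 1) = B - 1 := by rw [hB]; ring
    have e3 : A = B - D := by rw [hB]; ring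
    rw [e1, e2, hN, e3]
    have : B + 1 ≠ 0 := by linarith
    have : B ≠ 0 := by linarith
    have := hB1.ne'
    field_simp
    ring
  set m := min (c / 8) (κ / 12) with hm
  have m0 : 0 ≤ m := le_min (by positivity) (by positivity)
  have m1 : m ≤ c / 8 := min_le_left _ _
  have m2 : m ≤ κ / 12 := min_le_right _ _
  have hN1 : κ / 3 * (D ^ 3 / A ^ 4) * B + c ≤ N := by
    have : κ / 3 * (D ^ 3 / A ^ 4) * B ≤ (q - p) * B := by
      refine mul_le_mul_of_nonneg_right ?_ (by linarith)
      linarith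
    linarith
  have hq : 0 ≤ κ / 3 * (D ^ 3 / A ^ 4) * B := by positivity
  have main : m * B ^ 3 ≤ A ^ 3 * N := by
    rcases le_total D A with h | h
    · calc m * B ^ 3 ≤ c / 8 * (2 * A) ^ 3 := by
            gcongr
            linarith
        _ = A ^ 3 * c := by ring
        _ ≤ A ^ 3 * N := by gcongr; linarith
    · have hBD : B ≤ 2 * D := by linarith
      calc m * B ^ 3 = m * (B * B ^ 2) := by ring
        _ ≤ κ / 12 * (B * (2 * D) ^ 2) := by gcongr
        _ = κ / 3 * B * D ^ 2 * 1 := by ring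
        _ ≤ κ / 3 * B * D ^ 2 * (D / A) := by
            gcongr
            rwa [one_le_div hA0]
        _ = A ^ 3 * (κ / 3 * (D ^ 3 / A ^ 4) * B) := by field_simp
        _ ≤ A ^ 3 * N := by gcongr; linarith
  have hN0 : 0 ≤ N := by linarith
  rw [e, neg_le_neg_iff]
  calc m / A ^ 2 ≤ A * N / B ^ 3 := by
        rw [div_le_div_iff₀ (by positivity) (by positivity)]
        calc m * B ^ 3 ≤ A ^ 3 * N := main
          _ = A * N * A ^ 2 := by ring
    _ ≤ A * N / (B * ((B - 1) * (B + 1))) := by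
        have : 0 < B * ((B - 1) * (B + 1)) := by positivity
        gcongr
        nlinarith

/-- The rate, in units of `n ^ (-3 / 2)`, at which the distance function of two coupled plus
counts decreases. -/
noncomputable def coalescenceConst : ℝ := min (flipConst / 2 / 8) (driftConst / 12)

lemma coalescenceConst_pos : 0 < coalescenceConst := by
  have := flipConst_pos
  have := driftConst_pos
  exact lt_min (by positivity) (by positivity)

lemma pairStep_distance_le (hn : 1 ≤ n) {k l : ℤ} (hl : 0 ≤ l) (hlk : l < k) (hk : k ≤ n) :
    pairStep n (fun k l => ((k - l : ℤ) : ℝ) / (scale n + (k - l : ℤ))) k l ≤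
      ((k - l : ℤ) : ℝ) / (scale n + (k - l : ℤ)) - coalescenceConst / scale n ^ 2 := by
  have hn0 : (0 : ℝ) < n := by positivity
  have hn1 : (1 : ℝ) ≤ n := by exact_mod_cast hn
  have hl' : (0 : ℝ) ≤ l := by exact_mod_cast hl
  have hk' : (k : ℝ) ≤ n := by exact_mod_cast hk
  have hlk' : (l : ℝ) < k := by exact_mod_cast hlk
  have Uk := up_nonneg hk'
  have Ul := up_nonneg (hlk'.le.trans hk')
  have Dk := down_nonneg (n := n) (hl'.trans hlk'.le)
  have Dl := down_nonneg (n := n) hl'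
  have m1 : min (up n k) (up n l) ≤ up n k := min_le_left _ _
  have m2 : min (up n k) (up n l) ≤ up n l := min_le_right _ _
  have m3 : min (down n k) (down n l) ≤ down n k := min_le_left _ _
  have m4 : min (down n k) (down n l) ≤ down n l := min_le_right _ _
  set D : ℝ := ((k - l : ℤ) : ℝ) with hD
  have hD1 : 1 ≤ D := by rw [hD]; exact_mod_cast (by omega : 1 ≤ k - l)
  have key := concave_step_le (A := scale n) (D := D)
    (p := (up n k - 3 / 4 * min (up n k) (up n l)) +
      (down n l - 3 / 4 * min (down n k) (down n l)))
    (q := (down n k - 3 / 4 * min (down n k) (down n l)) +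
      (up n l - 3 / 4 * min (up n k) (up n l)))
    (c := flipConst / 2) (κ := driftConst) (one_le_scale hn) hD1 driftConst_pos.le
    (by linarith [flipConst_pos]) (by
      have hs : ∀ j : ℝ, 0 ≤ j → j ≤ n → |(2 * j - n) / n| ≤ 1 := fun j j0 jn => by
        rw [abs_div, abs_of_pos hn0, div_le_one hn0, abs_le]
        constructor <;> linarith
      have d := drift_sub_drift_le (h := 1 / n) (s := (2 * k - n) / n) (s' := (2 * l - n) / n)
        (by positivity) (by rw [div_le_one hn0]; exact hn1) (hs k (by linarith) hk')
        (hs l hl' (by linarith)) (by gcongr)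
      have u1 := up_sub_down hn (k : ℝ)
      have u2 := up_sub_down hn (l : ℝ)
      have e : ((2 * (k : ℝ) - n) / n - (2 * l - n) / n) ^ 3 = 8 * (D ^ 3 / scale n ^ 4) := by
        rw [scale_pow_four, hD]
        push_cast
        field_simp
        ring
      rw [e] at d
      linarith) (by
      have := flipConst_le_up_add_down hn (hl.trans hlk.le) hk
      linarith)
  have e1 : (((k + 1) - l : ℤ) : ℝ) = D + 1 := by rw [hD]; push_cast; ring
  have e2 : ((k - (l + 1) : ℤ) : ℝ) = D - 1 := by rw [hD]; push_cast; ring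
  have e3 : (((k - 1) - l : ℤ) : ℝ) = D - 1 := by rw [hD]; push_cast; ring
  have e4 : ((k - (l - 1) : ℤ) : ℝ) = D + 1 := by rw [hD]; push_cast; ring
  have e5 : (((k + 1) - (l + 1) : ℤ) : ℝ) = D := by rw [hD]; push_cast; ring
  have e6 : (((k - 1) - (l - 1) : ℤ) : ℝ) = D := by rw [hD]; push_cast; ring
  unfold pairStep
  dsimp only
  rw [e1, e2, e3, e4, e5, e6, ← hD]
  unfold coalescenceConst
  linarith

/-- The difference of the expected values of an observable for two starting points decays like
`n ^ (3 / 2) / t`. This is Markov's inequality for the coalescence time, in the form of an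
induction over `t`. -/
lemma abs_iterate_countStep_sub_le (hn : 1 ≤ n) {φ : ℤ → ℝ} (hφ : ∀ k, |φ k| ≤ 1) (t : ℕ)
    {k l : ℤ} (hl : 0 ≤ l) (hlk : l ≤ k) (hk : k ≤ n) :
    |((countStep n)^[t] φ) k - ((countStep n)^[t] φ) l| ≤ 2 ∧
      t * |((countStep n)^[t] φ) k - ((countStep n)^[t] φ) l| ≤
        2 * scale n ^ 2 / coalescenceConst *
          (((k - l : ℤ) : ℝ) / (scale n + (k - l : ℤ))) := by
  have hA := one_le_scale hn
  have hc := coalescenceConst_pos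
  induction t generalizing k l with
  | zero =>
    have hD : (0 : ℝ) ≤ ((k - l : ℤ) : ℝ) := by exact_mod_cast (by omega : 0 ≤ k - l)
    refine ⟨?_, ?_⟩
    · have := abs_sub (φ k) (φ l)
      simp only [Function.iterate_zero, id_eq]
      linarith [hφ k, hφ l]
    · rw [Nat.cast_zero, zero_mul]
      positivity
  | succ t ih =>
    rcases hlk.eq_or_lt with rfl | hlt
    · simp
    rw [Function.iterate_succ_apply', ← pairStep_sub]
    set W : ℤ → ℤ → ℝ := fun k l => ((countStep n)^[t] φ) k - ((countStep n)^[t] φ) l with hW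
    have h1 : |pairStep n W k l| ≤ 2 := by
      rw [← pairStep_const (n := n) 2 k l]
      exact abs_pairStep_le hn (fun k l a b c => (ih a b c).1) hl hlt hk
    refine ⟨h1, ?_⟩
    have h2 := abs_pairStep_le hn (u := fun k l => t * W k l)
      (v := fun k l => 2 * scale n ^ 2 / coalescenceConst *
          (((k - l : ℤ) : ℝ) / (scale n + (k - l : ℤ)))) (fun k l a b c => by
        rw [abs_mul, Nat.abs_cast]; exact (ih a b c).2) hl hlt hk
    rw [pairStep_mul, pairStep_mul, abs_mul, Nat.abs_cast] at h2
    have h3 := mul_le_mul_of_nonneg_left (pairStep_distance_le hn hl hlt hk)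
      (by positivity : 0 ≤ 2 * scale n ^ 2 / coalescenceConst)
    have e : 2 * scale n ^ 2 / coalescenceConst * (coalescenceConst / scale n ^ 2) = 2 := by
      field_simp
    rw [mul_sub, e] at h3
    rw [Nat.cast_succ]
    linarith

/-! ### The upper bound -/

lemma abs_iterate_countStep_sub_le_of_mem (hn : 1 ≤ n) {φ : ℤ → ℝ} (hφ : ∀ k, |φ k| ≤ 1) (t : ℕ)
    {k l : ℤ} (hk0 : 0 ≤ k) (hk : k ≤ n) (hl0 : 0 ≤ l) (hl : l ≤ n) :
    t * |((countStep n)^[t] φ) k - ((countStep n)^[t] φ) l| ≤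
      2 * scale n ^ 2 / coalescenceConst := by
  have hA := one_le_scale hn
  have hc := coalescenceConst_pos
  have key : ∀ k l : ℤ, 0 ≤ l → l ≤ k → k ≤ n →
      t * |((countStep n)^[t] φ) k - ((countStep n)^[t] φ) l| ≤
        2 * scale n ^ 2 / coalescenceConst := fun k l h0 h1 h2 => by
    have hD : (0 : ℝ) ≤ ((k - l : ℤ) : ℝ) := by exact_mod_cast (by omega : 0 ≤ k - l)
    refine ((abs_iterate_countStep_sub_le hn hφ t h0 h1 h2).2).trans ?_
    refine mul_le_of_le_one_right (by positivity) ?_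
    rw [div_le_one (by linarith)]
    linarith
  rcases le_total l k with h | h
  · exact key k l hl0 h hk
  · rw [abs_sub_comm]; exact key l k hk0 h hl

/-- An observable that nearly depends on the number of plus spins only is compared, up to its
defect `ε`, with a function of that number. -/
lemma iterate_step_sub_le_of_near (hn : 1 ≤ n) {g : Config (Fin n) → ℝ} (hg : ∀ σ, |g σ| ≤ 1)
    {ε : ℝ} (h : ∀ σ η, plusCount σ = plusCount η → |g σ - g η| ≤ ε) {r : ℕ} (hr : 0 < r)
    (σ η : Config (Fin n)) :
    ((step n)^[r] g) σ - ((step n)^[r] g) η ≤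
      2 * scale n ^ 2 / coalescenceConst / r + 2 * ε := by
  classical
  -- a configuration with `k` plus spins; the value for impossible `k` is irrelevant
  set rep : ℤ → Config (Fin n) := fun k =>
    if hk : ∃ ξ : Config (Fin n), plusCount ξ = k then hk.choose else 1 with hrep
  have hrep' : ∀ ξ : Config (Fin n), plusCount (rep (plusCount ξ)) = plusCount ξ := fun ξ => by
    have hk : ∃ ζ : Config (Fin n), plusCount ζ = plusCount ξ := ⟨ξ, rfl⟩
    simp only [hrep, dif_pos hk]
    exact hk.choose_spec
  set φ : ℤ → ℝ := fun k => g (rep k)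
  have hd : ∀ ξ, |((step n)^[r] g) ξ - ((countStep n)^[r] φ) (plusCount ξ)| ≤ ε := fun ξ => by
    rw [← iterate_step_comp_plusCount hn]
    have := abs_iterate_step_le hn r (f := g - fun ξ => φ (plusCount ξ)) (c := ε)
      (fun ξ => h _ _ (hrep' ξ).symm) ξ
    rwa [iterate_step_sub] at this
  have hr' : (0 : ℝ) < r := by exact_mod_cast hr
  have hc := abs_iterate_countStep_sub_le_of_mem hn (φ := φ) (fun k => hg _) r
    (plusCount_nonneg σ) (plusCount_le σ) (plusCount_nonneg η) (plusCount_le η)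
  rw [mul_comm, ← le_div_iff₀ hr'] at hc
  have h1 := (abs_le.1 (hd σ)).2
  have h2 := (abs_le.1 (hd η)).1
  have h3 := (abs_le.1 hc).2
  linarith

lemma sixteen_mul_pow_le (hn : 1 ≤ n) {s : ℕ} (hs : 6 / flipConst * scale n ^ 2 ≤ s) :
    16 * n * (1 - flipConst / n) ^ s ≤ 1 := by
  have hn0 : (0 : ℝ) < n := by positivity
  have hn1 : (1 : ℝ) ≤ n := by exact_mod_cast hn
  have c0 := flipConst_pos
  have c1 := flipConst_le_half
  set y := flipConst * s / n with hy
  have hp : 0 ≤ 1 - flipConst / n := by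
    rw [sub_nonneg, div_le_one hn0]; linarith
  have hb : (1 - flipConst / n) ^ s ≤ exp (-y) := by
    calc (1 - flipConst / n) ^ s ≤ exp (-(flipConst / n)) ^ s := by
          gcongr
          linarith [add_one_le_exp (-(flipConst / n))]
      _ = exp (-y) := by rw [← exp_nat_mul, hy]; congr 1; ring
  have hy1 : 6 * scale n ^ 2 / n ≤ y := by
    rw [hy]
    refine div_le_div_of_nonneg_right ?_ hn0.le
    calc 6 * scale n ^ 2 = flipConst * (6 / flipConst * scale n ^ 2) := by field_simp
      _ ≤ flipConst * s := by gcongr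
  have hy0 : 0 ≤ 6 * scale n ^ 2 / n := by positivity
  have hy2 : 36 * (n : ℝ) ≤ y ^ 2 := by
    calc 36 * (n : ℝ) = (6 * scale n ^ 2 / n) ^ 2 := by
          have := scale_pow_four (n := n)
          rw [div_pow, mul_pow, ← pow_mul, this]
          field_simp
          ring
      _ ≤ y ^ 2 := pow_le_pow_left₀ hy0 hy1 2
  have he : 16 * (n : ℝ) ≤ exp y := by
    have := quadratic_le_exp_of_nonneg (hy0.trans hy1)
    nlinarith [hy0.trans hy1]
  calc 16 * n * (1 - flipConst / n) ^ s ≤ exp y * exp (-y) := by gcongr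
    _ = 1 := by rw [← exp_add]; simp

lemma distToStationarity_le_of_le (hn : 1 ≤ n) {r s : ℕ}
    (hr : 8 / coalescenceConst * scale n ^ 2 ≤ r) (hs : 6 / flipConst * scale n ^ 2 ≤ s) :
    distToStationarity n 1 (r + s) ≤ 1 / 4 := by
  have hA := one_le_scale hn
  have hc := coalescenceConst_pos
  have hr0 : (0 : ℝ) < r := lt_of_lt_of_le (by positivity) hr
  have hp : 0 ≤ 1 - flipConst / n := by
    have hn1 : (1 : ℝ) ≤ n := by exact_mod_cast hn
    rw [sub_nonneg, div_le_one (by linarith)]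
    linarith [flipConst_le_half]
  refine distToStationarity_le hn fun f hf σ η => ?_
  rw [Function.iterate_add_apply]
  have h := iterate_step_sub_le_of_near hn (abs_iterate_step_le hn s hf)
    (abs_sub_le_of_plusCount_eq (by positivity)
      fun i j ξ => abs_iterate_step_sub_swap_le hn hf i j s ξ)
    (by exact_mod_cast hr0 : 0 < r) σ η
  refine h.trans ?_
  have h1 : 2 * scale n ^ 2 / coalescenceConst / r ≤ 1 / 4 := by
    rw [div_le_iff₀ hr0]
    calc 2 * scale n ^ 2 / coalescenceConst = 1 / 4 * (8 / coalescenceConst * scale n ^ 2) := by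
          ring
      _ ≤ 1 / 4 * (r : ℝ) := by gcongr
  have h2 := sixteen_mul_pow_le hn hs
  linarith

end CurieWeiss

theorem theorem2 :
    ∃ C₁ C₂ : ℝ, 0 < C₁ ∧ 0 < C₂ ∧ ∀ n : ℕ, 1 ≤ n →
      C₁ * (n : ℝ) ^ (3 / 2 : ℝ) ≤ (CurieWeiss.tMix n 1 : ℝ) ∧
        (CurieWeiss.tMix n 1 : ℝ) ≤ C₂ * (n : ℝ) ^ (3 / 2 : ℝ) := by
  have hc := CurieWeiss.coalescenceConst_pos
  have hf := CurieWeiss.flipConst_pos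
  refine ⟨1 / 40, 8 / CurieWeiss.coalescenceConst + 6 / CurieWeiss.flipConst + 2, by norm_num,
    by positivity, fun n hn => ?_⟩
  set A := CurieWeiss.scale n with hA
  have hA1 : 1 ≤ A ^ 2 := one_le_pow₀ (CurieWeiss.one_le_scale hn)
  have hmem := CurieWeiss.distToStationarity_le_of_le hn
    (Nat.le_ceil (8 / CurieWeiss.coalescenceConst * A ^ 2))
    (Nat.le_ceil (6 / CurieWeiss.flipConst * A ^ 2))
  constructor
  · exact CurieWeiss.le_of_distToStationarity_le hn
      (Nat.sInf_mem (s := {t : ℕ | CurieWeiss.distToStationarity n 1 t ≤ 1 / 4}) ⟨_, hmem⟩)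
  · rw [← CurieWeiss.scale_sq, ← hA]
    have h1 : (CurieWeiss.tMix n 1 : ℝ) ≤ ((⌈8 / CurieWeiss.coalescenceConst * A ^ 2⌉₊ +
        ⌈6 / CurieWeiss.flipConst * A ^ 2⌉₊ : ℕ) : ℝ) := by
      exact_mod_cast Nat.sInf_le hmem
    have h2 := (Nat.ceil_lt_add_one
      (by positivity : 0 ≤ 8 / CurieWeiss.coalescenceConst * A ^ 2)).le
    have h3 := (Nat.ceil_lt_add_one (by positivity : 0 ≤ 6 / CurieWeiss.flipConst * A ^ 2)).le
    push_cast at h1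
    linarith
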